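/- **Theorem.** Let $\zeta\colon B\to M$ and $\pi\colon M\to N$ be smooth fibre bundles of finite-dimensional smooth manifolds, let $\mathcal{E}^0\subset J^k(\zeta)$ be a formally integrable differential equation (i.e. $\mathcal{E}^0\to M$ is onto, all prolongations $\mathcal{E}^l\subset J^{k+l}(\zeta)$, $l\ge 0$, are submanifolds and all $\mathcal{E}^{l+1}\to\mathcal{E}^l$ are smooth fibre bundles), and let $\xi\colon\mathcal{E}\to M$, $\mathcal{E}\subset J^\infty(\zeta)$, be its infinite prolongation. Let $C^\infty(\mathcal{E})$ be the algebra of smooth functions on $\mathcal{E}$ (of finite jet order), $D(\mathcal{E})$ the Lie algebra of its $\mathbb{R}$-linear derivations, and $\mathcal{C}D\subset D(\mathcal{E})$ the submodule of vector fields lying in the Cartan distribution, i.e. tangent at each $\theta=[s]_x^\infty\in\mathcal{E}$ to the graph of $j_\infty(s)$. Let $\mathrm{sym}\,\mathcal{E}$ be the Lie algebra of symmetries: those $S\in D(\mathcal{E})$ with $S(\xi^*f)=0$ for all $f\in C^\infty(M)$ and $[S,\mathcal{C}D]\subset\mathcal{C}D$. Put $\eta=\pi\circ\xi\colon\mathcal{E}\to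 N$, and let $\mathcal{F}$ be a flat representation of $\mathcal{E}$, i.e. a flat connection in $\eta$ such that $\mathcal{F}(X)\in\mathcal{C}D$ for every vector field $X$ on $N$. Let $U\in D(\Lambda^1(\mathcal{E}))$ be the derivation given by $X\,\lrcorner\,U(f)=\mathcal{F}(X|_N)(f)$ for $X\in D(\mathcal{E})$, $f\in C^\infty(\mathcal{E})$, where $X|_N=X\circ\eta^*$ and $\mathcal{F}$ is extended $C^\infty(\mathcal{E})$-linearly to $C^\infty(\mathcal{E})$-valued derivations of $C^\infty(N)$. Let $\mathcal{V}_\mathcal{E}\subset\mathcal{C}D$ be the submodule of $\eta$-vertical fields, let $\mathcal{V}_\mathcal{E}^q=\eta^*(\Lambda^q(N))\otimes\mathcal{V}_\mathcal{E}\subset D(\Lambda^q(\mathcal{E}))$ be the module of $\eta$-horizontal $q$-forms with values in $\mathcal{V}_\mathcal{E}$, and consider the deformation complex $\mathcal{V}_\mathcal{E}^0=\mathcal{V}_\mathcal{E}\to\mathcal{V}_\mathcal{E}^1\to\mathcal{V}_\mathcal{E}^2\to\cdots$ with differential $\partial_U=[\![U,\cdot]\!]$, where $[\![\cdot,\cdot]\!]$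 is the (Frölicher–)Nijenhuis bracket. Then for each symmetry $S\in\mathrm{sym}\,\mathcal{E}$ the element $c_S=[\![U,S]\!]$ is a $1$-cocycle of this complex, i.e. $c_S\in\mathcal{V}_\mathcal{E}^1$ and $\partial_U c_S=0$. The symmetries $S$ for which $c_S$ is exact, i.e. $c_S=[\![U,V]\!]$ for some $V\in\mathcal{V}_\mathcal{E}$, form a Lie subalgebra of $\mathrm{sym}\,\mathcal{E}$. -/

import Mathlib

open scoped Manifold ContDiff

noncomputable section

namespace FlatRep

/-! ## Smooth fibre bundles -/

/-- The model space `ℝⁿ` of all finite-dimensional manifolds below. -/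
abbrev Euc (n : ℕ) : Type := EuclideanSpace ℝ (Fin n)

/-- `p : E → M` is a smooth locally trivial fibre bundle: a smooth surjection which over a
neighbourhood of each point of the base is diffeomorphic to a product projection. -/
def IsSmoothFiberBundle.{u, v} {e n : ℕ} {E : Type u} {M : Type v}
    [TopologicalSpace E] [ChartedSpace (Euc e) E] [TopologicalSpace M] [ChartedSpace (Euc n) M]
    (p : E → M) : Prop :=
  ContMDiff (𝓡 e) (𝓡 n) ∞ p ∧ Function.Surjective p ∧
    ∀ x : M, ∃ (q : ℕ) (F : Type u) (_ : TopologicalSpace F) (_ : ChartedSpace (Euc q) F)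
      (_ : IsManifold (𝓡 q) ∞ F) (t : Bundle.Trivialization F p),
      x ∈ t.baseSet ∧
      ContMDiffOn (𝓡 e) ((𝓡 n).prod (𝓡 q)) ∞ t t.source ∧
      ContMDiffOn ((𝓡 n).prod (𝓡 q)) (𝓡 e) ∞ t.toOpenPartialHomeomorph.symm t.target

/-! ## Vector fields and orders of vanishing on the base -/

section Base

variable (n : ℕ) (M : Type*) [TopologicalSpace M] [ChartedSpace (Euc n) M]
  [IsManifold (𝓡 n) ∞ M]

/-- Smooth vector fields on `M`, as smooth sections of the tangent bundle. -/
abbrev VecField : Type _ := Cₛ^∞⟮𝓡 n; Euc n, (TangentSpace (𝓡 n) : M → Type _)⟯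

variable {n M}

/-- The derivative `Z h` of a (locally smooth) function `h` along a vector field `Z`. -/
def dirDeriv (Z : VecField n M) (h : M → ℝ) : M → ℝ :=
  fun x => mfderiv (𝓡 n) 𝓘(ℝ, ℝ) h x (Z x)

/-- The iterated derivative `Z₁ (Z₂ (⋯ (Z_j h)))`. -/
def iterDeriv (Zs : List (VecField n M)) (h : M → ℝ) : M → ℝ :=
  Zs.foldr dirDeriv h

/-- All derivatives of `h` of order `≤ l` vanish at `x` (the value `h x` included). -/
def VanishesToOrder (l : ℕ∞) (h : M → ℝ) (x : M) : Prop :=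
  ∀ Zs : List (VecField n M), (Zs.length : ℕ∞) ≤ l → iterDeriv Zs h x = 0

end Base

/-! ## Differential structures generated by functions -/

/-- `f` is, near every point, a smooth function of finitely many functions from `Φ`, where
"near" refers to the topology defined by `Φ`. -/
def SmoothlyGenerated {X : Type*} (Φ : Set (X → ℝ)) (f : X → ℝ) : Prop :=
  ∀ x₀ : X, ∃ (ι : Type) (_ : Fintype ι) (φ : ι → X → ℝ) (H : (ι → ℝ) → ℝ),
    (∀ i, φ i ∈ Φ) ∧ ContDiff ℝ ∞ H ∧
    ∃ ε > 0, ∀ x, (∀ i, |φ i x - φ i x₀| < ε) → f x = H (fun i => φ i x)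

theorem SmoothlyGenerated.mono {X : Type*} {Φ Ψ : Set (X → ℝ)} (h : Φ ⊆ Ψ) {f : X → ℝ}
    (hf : SmoothlyGenerated Φ f) : SmoothlyGenerated Ψ f := by
  intro x₀
  obtain ⟨ι, i, φ, H, h1, h2, h3⟩ := hf x₀
  exact ⟨ι, i, φ, H, fun a => h (h1 a), h2, h3⟩

theorem SmoothlyGenerated.of_mem {X : Type*} {Φ : Set (X → ℝ)} {f : X → ℝ} (hf : f ∈ Φ) :
    SmoothlyGenerated Φ f := by
  intro x₀
  exact ⟨Unit, inferInstance, fun _ => f, fun y => y (), fun _ => hf, by fun_prop, 1, one_pos,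
    fun _ _ => rfl⟩

theorem SmoothlyGenerated.const {X : Type*} (Φ : Set (X → ℝ)) (c : ℝ) :
    SmoothlyGenerated Φ (fun _ => c) := by
  intro x₀
  exact ⟨Empty, inferInstance, fun i => i.elim, fun _ => c, fun i => i.elim, by fun_prop, 1,
    one_pos, fun _ _ => rfl⟩

theorem SmoothlyGenerated.comp₂ {X : Type*} {Φ : Set (X → ℝ)} {f g : X → ℝ} {B : ℝ × ℝ → ℝ}
    (hB : ContDiff ℝ ∞ B) (hf : SmoothlyGenerated Φ f) (hg : SmoothlyGenerated Φ g) :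
    SmoothlyGenerated Φ (fun x => B (f x, g x)) := by
  intro x₀
  obtain ⟨ι, _, φ, H, h1, h2, ε, hε, h3⟩ := hf x₀
  obtain ⟨κ, _, ψ, K, k1, k2, δ, hδ, k3⟩ := hg x₀
  refine ⟨ι ⊕ κ, inferInstance, Sum.elim φ ψ,
    fun y => B (H (fun i => y (Sum.inl i)), K (fun i => y (Sum.inr i))), ?_, ?_,
    min ε δ, lt_min hε hδ, ?_⟩
  · rintro (i | i)
    · exact h1 i
    · exact k1 i
  · fun_prop
  · intro x hx
    have e1 := h3 x (fun i => lt_of_lt_of_le (hx (Sum.inl i)) (min_le_left _ _))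
    have e2 := k3 x (fun i => lt_of_lt_of_le (hx (Sum.inr i)) (min_le_right _ _))
    simp only [e1, e2, Sum.elim_inl, Sum.elim_inr]

/-! ## Vector-valued forms and the Nijenhuis bracket -/

section Nijenhuis

variable (A : Type*) [CommRing A] [Algebra ℝ A]

/-- The module `Λʲ` of `j`-forms: alternating `A`-multilinear maps of `j` vector fields, vector
fields being the derivations of the function algebra `A`. -/
abbrev Form (j : ℕ) : Type _ := (Derivation ℝ A A) [⋀^Fin j]→ₗ[A] A

/-- The module `D(Λʲ)` of `Λʲ`-valued derivations of `A`. -/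
abbrev VForm (j : ℕ) : Type _ := Derivation ℝ A (Form A j)

/-- Underlying functions of forms. The operations below are given by the usual global formulas. -/
abbrev PreForm (j : ℕ) : Type _ := (Fin j → Derivation ℝ A A) → A

variable {A}

/-- The vector field `f ↦ Ω(f)(X₁, …, X_j)`. -/
def VForm.at {j : ℕ} (Ω : VForm A j) (X : Fin j → Derivation ℝ A A) : Derivation ℝ A A :=
  Derivation.mk'
    { toFun := fun f => Ω f X
      map_add' := fun f g => by rw [map_add]; rfl
      map_smul' := fun c f => by rw [Derivation.map_smul]; rfl }
    (fun f g => by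
      change Ω (f * g) X = _
      rw [Derivation.leibniz]; rfl)

/-- A vector field as an element of `D(Λ⁰)`, where `Λ⁰ = A`. -/
def VForm.ofField (X : Derivation ℝ A A) : VForm A 0 :=
  Derivation.mk'
    { toFun := fun f => AlternatingMap.constOfIsEmpty A (Derivation ℝ A A) (Fin 0) (X f)
      map_add' := fun f g => by rw [map_add]; rfl
      map_smul' := fun c f => by rw [Derivation.map_smul]; rfl }
    (fun f g => by
      change AlternatingMap.constOfIsEmpty A (Derivation ℝ A A) (Fin 0) (X (f * g)) = _
      rw [Derivation.leibniz]; rfl)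

/-- A function as a `0`-form. -/
def preFun (f : A) : PreForm A 0 := fun _ => f

/-- The de Rham differential
`dw(X₀,…,X_j) = ∑_b (-1)^b X_b w(…, X̂_b, …) + ∑_{a<b} (-1)^b w(…, [X_a, X_b], …, X̂_b, …)`
with `[X_a, X_b]` in the place of `X_a`. -/
def extD {j : ℕ} (w : PreForm A j) : PreForm A (j + 1) := fun X =>
  ∑ b : Fin (j + 1), (-1 : A) ^ (b : ℕ) *
    (X b (w (fun i => X (b.succAbove i))) +
      ∑ c : Fin j, if b.succAbove c < b then
        w (Function.update (fun i => X (b.succAbove i)) c ⁅X (b.succAbove c), X b⁆) else 0)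

/-- The inner product `Ω ⌟ w` of `Ω ∈ D(Λⁱ)` with a form of positive degree:
`(Ω ⌟ w)(X₁,…,X_{i+j}) = 1/(i! j!) ∑_σ sgn σ · w(Ω(X_{σ1},…,X_{σi}), X_{σ(i+1)}, …)`. -/
def inner {i j : ℕ} (Ω : VForm A i) (w : PreForm A (j + 1)) : PreForm A (i + j) := fun X =>
  ((i.factorial : ℝ) * (j.factorial : ℝ))⁻¹ •
    ∑ σ : Equiv.Perm (Fin (i + j)), ((Equiv.Perm.sign σ : ℤˣ) : ℤ) •
      w (Fin.cons (Ω.at fun a => X (σ (Fin.castAdd j a))) fun c => X (σ (Fin.natAdd i c)))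

/-- The Lie derivative `L_Ω w = d(Ω ⌟ w) + (-1)ⁱ Ω ⌟ dw` for `Ω ∈ D(Λⁱ)`; on functions the first
term is absent. -/
def lieD {i : ℕ} (Ω : VForm A i) : {j : ℕ} → PreForm A j → PreForm A (i + j)
  | 0, w => (-1 : A) ^ i • inner Ω (extD w)
  | _ + 1, w => extD (inner Ω w) + (-1 : A) ^ i • inner Ω (extD w)

/-- `Ψ` is the Nijenhuis bracket `⟦Ω, Ω'⟧` of `Ω ∈ D(Λⁱ)` and `Ω' ∈ D(Λ^{i'})`: one has
`L_Ψ = L_Ω L_Ω' - (-1)^{i i'} L_Ω' L_Ω`. Since `L_Ψ f = ± Ψ(f)` on functions `f`, the identity on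
functions already determines `Ψ`, and it is the one required here. -/
def IsNijenhuis {i i' : ℕ} (Ω : VForm A i) (Ω' : VForm A i') (Ψ : VForm A (i + i')) : Prop :=
  ∀ (f : A) (X : Fin (i + i') → Derivation ℝ A A),
    lieD Ψ (preFun f) X =
      lieD Ω (lieD Ω' (preFun f)) X -
        (-1 : A) ^ (i * i') * lieD Ω' (lieD Ω (preFun f)) (fun a => X (Fin.cast (add_comm i' i) a))

end Nijenhuis

/-! ## Relative derivations, connections and symmetries -/

section Relative

variable {A' A : Type*} [CommRing A'] [Algebra ℝ A'] [CommRing A] [Algebra ℝ A]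

/-- For an algebra map `ρ : A' → A`, the `A`-module of `A`-valued derivations of `A'`. -/
def RelDer (ρ : A' →ₐ[ℝ] A) : Submodule A (A' →ₗ[ℝ] A) where
  carrier := {X | ∀ f g : A', X (f * g) = ρ f * X g + ρ g * X f}
  add_mem' := by
    intro X Y hX hY f g
    rw [LinearMap.add_apply, hX, hY, LinearMap.add_apply, LinearMap.add_apply]
    ring
  zero_mem' := by intro f g; simp
  smul_mem' := by
    intro a X hX f g
    simp only [LinearMap.smul_apply, hX f g, smul_eq_mul]
    ring

/-- The restriction `X ↦ X ∘ ρ` of derivations of `A`. -/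
def resDer (ρ : A' →ₐ[ℝ] A) : Derivation ℝ A A →ₗ[A] RelDer ρ where
  toFun X := ⟨(X : A →ₗ[ℝ] A).comp ρ.toLinearMap, by
    intro f g
    change X (ρ (f * g)) = ρ f * X (ρ g) + ρ g * X (ρ f)
    rw [map_mul, Derivation.leibniz, smul_eq_mul, smul_eq_mul]⟩
  map_add' _ _ := rfl
  map_smul' _ _ := rfl

/-- A derivation of `A'` as an `A`-valued derivation. -/
def inclDer (ρ : A' →ₐ[ℝ] A) (X : Derivation ℝ A' A') : RelDer ρ :=
  ⟨ρ.toLinearMap.comp (X : A' →ₗ[ℝ] A'), by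
    intro f g
    change ρ (X (f * g)) = ρ f * ρ (X g) + ρ g * ρ (X f)
    rw [Derivation.leibniz, smul_eq_mul, smul_eq_mul, map_add, map_mul, map_mul]⟩

/-- The vertical derivations of `A`: those that vanish on the image of `ρ`. -/
def verticalDer (ρ : A' →ₐ[ℝ] A) : Submodule A (Derivation ℝ A A) :=
  LinearMap.ker (resDer ρ)

/-- The form `Ū ∈ D(Λ¹)` of a connection `∇`: `X ⌟ Ū(f) = (∇ X|_{A'})(f)`. -/
def connForm (ρ : A' →ₐ[ℝ] A) (conn : RelDer ρ →ₗ[A] Derivation ℝ A A) : VForm A 1 :=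
  Derivation.mk'
    { toFun := fun f => AlternatingMap.ofSubsingleton A (Derivation ℝ A A) A (0 : Fin 1)
        { toFun := fun X => conn (resDer ρ X) f
          map_add' := fun X Y => by rw [map_add, map_add]; rfl
          map_smul' := fun a X => by rw [map_smul, map_smul]; rfl }
      map_add' := fun f g => by
        ext X
        exact map_add (conn (resDer ρ (X 0))) f g
      map_smul' := fun c f => by
        ext X
        exact Derivation.map_smul (conn (resDer ρ (X 0))) c f }
    (fun f g => by
      ext X
      exact Derivation.leibniz (conn (resDer ρ (X 0))) f g)

/-- The horizontal `q`-forms (those that vanish when one argument is vertical) with values in a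
module `P` of derivations. -/
def horizontalForms (ρ : A' →ₐ[ℝ] A) (P : Submodule A (Derivation ℝ A A)) (q : ℕ) :
    Submodule A (VForm A q) where
  carrier := {Ω | (∀ X : Fin q → Derivation ℝ A A, Ω.at X ∈ P) ∧
    ∀ X : Fin q → Derivation ℝ A A, (∃ a, X a ∈ verticalDer ρ) → Ω.at X = 0}
  add_mem' := by
    rintro Ω Ω' ⟨h1, h2⟩ ⟨k1, k2⟩
    have e : ∀ X : Fin q → Derivation ℝ A A, (Ω + Ω').at X = Ω.at X + Ω'.at X := fun X => rfl
    exact ⟨fun X => by rw [e]; exact add_mem (h1 X) (k1 X),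
      fun X hX => by rw [e, h2 X hX, k2 X hX, add_zero]⟩
  zero_mem' := ⟨fun X => zero_mem P, fun _ _ => rfl⟩
  smul_mem' := by
    rintro a Ω ⟨h1, h2⟩
    have e : ∀ X : Fin q → Derivation ℝ A A, (a • Ω).at X = a • Ω.at X := fun X => rfl
    exact ⟨fun X => by rw [e]; exact Submodule.smul_mem _ a (h1 X),
      fun X hX => by rw [e, h2 X hX, smul_zero]⟩

/-- The Lie algebra of vertical derivations `S` that preserve a module `C` of derivations,
`[S, C] ⊆ C`. -/
def verticalPreserving (ρ : A' →ₐ[ℝ] A) (C : Submodule A (Derivation ℝ A A)) :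
    LieSubalgebra ℝ (Derivation ℝ A A) where
  carrier := {S | (∀ h : A', S (ρ h) = 0) ∧ ∀ Y ∈ C, ⁅S, Y⁆ ∈ C}
  add_mem' := by
    rintro S T ⟨h1, h2⟩ ⟨k1, k2⟩
    refine ⟨fun h => ?_, fun Y hY => ?_⟩
    · rw [Derivation.add_apply, h1, k1, add_zero]
    · rw [add_lie]; exact add_mem (h2 Y hY) (k2 Y hY)
  zero_mem' := ⟨fun _ => rfl, fun Y _ => by rw [zero_lie]; exact zero_mem _⟩
  smul_mem' := by
    rintro c S ⟨h1, h2⟩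
    refine ⟨fun h => ?_, fun Y hY => ?_⟩
    · rw [Derivation.smul_apply, h1, smul_zero]
    · rw [smul_lie]; exact Submodule.smul_of_tower_mem _ c (h2 Y hY)
  lie_mem' := by
    rintro S T ⟨h1, h2⟩ ⟨k1, k2⟩
    refine ⟨fun h => ?_, fun Y hY => ?_⟩
    · rw [Derivation.commutator_apply, h1, k1, map_zero, map_zero, sub_zero]
    · rw [lie_lie]; exact sub_mem (h2 _ (k2 Y hY)) (k2 _ (h2 Y hY))

end Relative

/-! ## Jets -/

section Jets

variable {b n : ℕ} {B M : Type*}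
  [TopologicalSpace B] [ChartedSpace (Euc b) B]
  [TopologicalSpace M] [ChartedSpace (Euc n) M]

/-- A local section of `ζ : B → M`; values outside the open set `dom` are irrelevant. -/
structure LocalSection (ζ : C^∞⟮𝓡 b, B; 𝓡 n, M⟯) where
  /-- the domain -/
  dom : Set M
  /-- the underlying map -/
  toFun : M → B
  isOpen_dom : IsOpen dom
  smooth : ContMDiffOn (𝓡 n) (𝓡 b) ∞ toFun dom
  section_eq : ∀ x ∈ dom, ζ (toFun x) = x

/-- A local section together with a point of its domain. -/
structure PointedSection (ζ : C^∞⟮𝓡 b, B; 𝓡 n, M⟯) where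
  /-- the section -/
  sec : LocalSection ζ
  /-- the point -/
  pt : M
  mem : pt ∈ sec.dom

variable [IsManifold (𝓡 n) ∞ M]

/-- The derivative `Z₁ ⋯ Z_j (g ∘ s) (x)` for a local section `s` at `x` and a smooth function
`g` on the total space. -/
def PointedSection.deriv {ζ : C^∞⟮𝓡 b, B; 𝓡 n, M⟯} (σ : PointedSection ζ)
    (g : C^∞⟮𝓡 b, B; ℝ⟯) (Zs : List (VecField n M)) : ℝ :=
  iterDeriv Zs (fun y => g (σ.sec.toFun y)) σ.pt

/-- Tangency of order `≥ k` of the graphs of two local sections: they have the same base point,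
and there all derivatives of order `≤ k` agree. -/
def jetSetoid (ζ : C^∞⟮𝓡 b, B; 𝓡 n, M⟯) (k : ℕ∞) : Setoid (PointedSection ζ) where
  r σ τ := σ.pt = τ.pt ∧ ∀ (g : C^∞⟮𝓡 b, B; ℝ⟯) (Zs : List (VecField n M)),
    (Zs.length : ℕ∞) ≤ k → σ.deriv g Zs = τ.deriv g Zs
  iseqv :=
    { refl := fun _ => ⟨rfl, fun _ _ _ => rfl⟩
      symm := fun h => ⟨h.1.symm, fun g Zs hZ => (h.2 g Zs hZ).symm⟩
      trans := fun h h' => ⟨h.1.trans h'.1, fun g Zs hZ => (h.2 g Zs hZ).trans (h'.2 g Zs hZ)⟩ }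

/-- The space `Jᵏ(ζ)` of `k`-jets `[s]ₓᵏ`; `k = ⊤` gives the infinite jets. -/
def Jet (ζ : C^∞⟮𝓡 b, B; 𝓡 n, M⟯) (k : ℕ∞) : Type _ := Quotient (jetSetoid ζ k)

variable {ζ : C^∞⟮𝓡 b, B; 𝓡 n, M⟯}

/-- The jet `[s]ₓᵏ`. -/
def jet (k : ℕ∞) (s : LocalSection ζ) (x : M) (hx : x ∈ s.dom) : Jet ζ k :=
  Quotient.mk (jetSetoid ζ k) ⟨s, x, hx⟩

/-- The projection `Jᵏ(ζ) → M`. -/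
def Jet.base {k : ℕ∞} (θ : Jet ζ k) : M :=
  Quotient.lift (s := jetSetoid ζ k) PointedSection.pt (fun _ _ h => h.1) θ

/-- The projection `Jˡ(ζ) → Jᵏ(ζ)` for `k ≤ l`. -/
def Jet.proj {k l : ℕ∞} (h : k ≤ l) (θ : Jet ζ l) : Jet ζ k :=
  Quotient.map (sa := jetSetoid ζ l) (sb := jetSetoid ζ k) id
    (fun _ _ H => ⟨H.1, fun g Zs hZ => H.2 g Zs (hZ.trans h)⟩) θ

/-- The jet function `[s]ₓᵏ ↦ Z₁ ⋯ Z_j (g ∘ s) (x)`, `j ≤ k`. For coordinate functions `g` and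
coordinate fields `Z_i` (cut off by bump functions) these are the adapted coordinates
on `Jᵏ(ζ)`. -/
def jetCoord {k : ℕ∞} (g : C^∞⟮𝓡 b, B; ℝ⟯) (Zs : List (VecField n M))
    (hZ : (Zs.length : ℕ∞) ≤ k) (θ : Jet ζ k) : ℝ :=
  Quotient.lift (s := jetSetoid ζ k) (fun σ : PointedSection ζ => σ.deriv g Zs) (fun _ _ h => h.2 g Zs hZ) θ

/-- The jet functions of order `≤ r` pulled back along `ι : X → Jᵏ(ζ)`. -/
def jetCoords {X : Type*} {k : ℕ∞} (ι : X → Jet ζ k) (r : ℕ) : Set (X → ℝ) :=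
  {φ | ∃ (g : C^∞⟮𝓡 b, B; ℝ⟯) (Zs : List (VecField n M)) (hZ : (Zs.length : ℕ∞) ≤ k),
    Zs.length ≤ r ∧ φ = fun x => jetCoord g Zs hZ (ι x)}

theorem jetCoords_mono {X : Type*} {k : ℕ∞} (ι : X → Jet ζ k) {r r' : ℕ} (h : r ≤ r') :
    jetCoords ι r ⊆ jetCoords ι r' := by
  rintro φ ⟨g, Zs, hZ, h1, h2⟩
  exact ⟨g, Zs, hZ, h1.trans h, h2⟩

/-- The algebra of smooth functions for the structure induced by `ι : X → Jᵏ(ζ)`: the functions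
that are locally smooth functions of the jet coordinates of some finite order `≤ r`.
For `ι = id` and finite `k` this is `C^∞(Jᵏ(ζ))`, for `ι = id` and `k = ⊤` it is
`C^∞(J^∞(ζ)) = ⋃ᵣ C^∞(Jʳ(ζ))`, and for the inclusion of a subset it consists of the functions
that locally extend to smooth functions on the ambient jet space. -/
def smoothFunctions {X : Type*} {k : ℕ∞} (ι : X → Jet ζ k) : Subalgebra ℝ (X → ℝ) where
  carrier := {f | ∃ r : ℕ, SmoothlyGenerated (jetCoords ι r) f}
  mul_mem' := by
    rintro f g ⟨r, hf⟩ ⟨s, hg⟩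
    exact ⟨max r s, SmoothlyGenerated.comp₂ (B := fun y => y.1 * y.2) (by fun_prop)
      (hf.mono (jetCoords_mono ι (le_max_left r s)))
      (hg.mono (jetCoords_mono ι (le_max_right r s)))⟩
  add_mem' := by
    rintro f g ⟨r, hf⟩ ⟨s, hg⟩
    exact ⟨max r s, SmoothlyGenerated.comp₂ (B := fun y => y.1 + y.2) (by fun_prop)
      (hf.mono (jetCoords_mono ι (le_max_left r s)))
      (hg.mono (jetCoords_mono ι (le_max_right r s)))⟩
  algebraMap_mem' := fun c => ⟨0, SmoothlyGenerated.const _ c⟩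

theorem smoothFunctions_comp {X Y : Type*} {k : ℕ∞} (ι : X → Jet ζ k) (j : Y → X) {f : X → ℝ}
    (hf : f ∈ smoothFunctions ι) : f ∘ j ∈ smoothFunctions (ι ∘ j) := by
  obtain ⟨r, hr⟩ := hf
  refine ⟨r, fun y₀ => ?_⟩
  obtain ⟨κ, i, φ, H, h1, h2, ε, hε, h3⟩ := hr (j y₀)
  refine ⟨κ, i, fun a => φ a ∘ j, H, fun a => ?_, h2, ε, hε, fun y hy => h3 (j y) hy⟩
  obtain ⟨g, Zs, hZ, hl, he⟩ := h1 a
  exact ⟨g, Zs, hZ, hl, by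
    change φ a ∘ j = _
    rw [he]; rfl⟩

/-- The function `F ∘ j_k(s)` on the domain of `s` (extended by `0` outside the domain). -/
def LocalSection.pull {k : ℕ∞} (s : LocalSection ζ) (F : Jet ζ k → ℝ) : M → ℝ :=
  open Classical in fun y => if h : y ∈ s.dom then F (jet k s y h) else 0

/-! ## Differential equations and prolongations -/

/-- The graph of `j_k(s)` is tangent with order `≥ l` to `E₀ ⊆ Jᵏ(ζ)` at `[s]ₓᵏ ∈ E₀`. -/
def TangentToOrder {k : ℕ} (E₀ : Set (Jet ζ k)) (l : ℕ∞) (s : LocalSection ζ) (x : M)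
    (hx : x ∈ s.dom) : Prop :=
  jet k s x hx ∈ E₀ ∧ ∀ G ∈ smoothFunctions (id : Jet ζ k → Jet ζ k),
    (∀ θ ∈ E₀, G θ = 0) → VanishesToOrder (n := n) l (s.pull G) x

/-- The jets `[s]ₓʳ` of the sections `s` such that the graph of `j_k(s)` is tangent to `E₀` with
order `≥ l` at `[s]ₓᵏ`. The `l`-th prolongation is the case `r = k + l`. -/
def prolongSet {k : ℕ} (E₀ : Set (Jet ζ k)) (l r : ℕ∞) : Set (Jet ζ r) :=
  {θ | ∃ (s : LocalSection ζ) (x : M) (hx : x ∈ s.dom),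
    TangentToOrder E₀ l s x hx ∧ θ = jet r s x hx}

/-- The `l`-th prolongation `Eˡ ⊆ J^{k+l}(ζ)` of `E₀ ⊆ Jᵏ(ζ)`. -/
abbrev prolong {k : ℕ} (E₀ : Set (Jet ζ k)) (l : ℕ) : Set (Jet ζ (k + l : ℕ)) :=
  prolongSet E₀ l (k + l : ℕ)

/-- The infinite prolongation `E = E^∞ ⊆ J^∞(ζ)`. -/
abbrev infProlong {k : ℕ} (E₀ : Set (Jet ζ k)) : Set (Jet ζ ⊤) :=
  prolongSet E₀ ⊤ ⊤

/-- The projection `E^{l+1} → Eˡ`. -/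
def prolongProj {k : ℕ} (E₀ : Set (Jet ζ k)) (l : ℕ) (θ : prolong E₀ (l + 1)) : prolong E₀ l :=
  ⟨Jet.proj (by exact_mod_cast Nat.le_succ (k + l)) θ.1, by
    obtain ⟨_, s, x, hx, ⟨h1, h2⟩, rfl⟩ := θ
    exact ⟨s, x, hx, ⟨h1, fun G hG h0 Zs hZ => h2 G hG h0 Zs
      (hZ.trans (by exact_mod_cast Nat.le_succ l))⟩, rfl⟩⟩

/-- A structure of an (embedded) submanifold on a subset `S` of a jet space: a smooth manifold
structure on `S` whose smooth functions are those that locally extend to the jet space. -/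
structure SubmanifoldStructure {k : ℕ∞} (S : Set (Jet ζ k)) where
  /-- the dimension -/
  dim : ℕ
  /-- the topology -/
  top : TopologicalSpace S
  /-- the atlas -/
  charted : ChartedSpace (Euc dim) S
  isManifold : IsManifold (𝓡 dim) ∞ S
  t2 : T2Space S
  secondCountable : SecondCountableTopology S
  smooth_iff : ∀ f : S → ℝ, ContMDiff (𝓡 dim) 𝓘(ℝ, ℝ) ∞ f ↔
    f ∈ smoothFunctions (Subtype.val : S → Jet ζ k)

/-- `E₀ ⊆ Jᵏ(ζ)` is a formally integrable differential equation: it projects onto `M`, all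
prolongations `Eˡ` (`E⁰ = E₀` included) are submanifolds and all `E^{l+1} → Eˡ` are smooth fibre
bundles. -/
def IsFormallyIntegrable {k : ℕ} (E₀ : Set (Jet ζ k)) : Prop :=
  (∀ x : M, ∃ θ ∈ E₀, θ.base = x) ∧
  ∃ m : ∀ l : ℕ, SubmanifoldStructure (prolong E₀ l), ∀ l : ℕ,
    letI := (m l).top
    letI := (m l).charted
    letI := (m (l + 1)).top
    letI := (m (l + 1)).charted
    IsSmoothFiberBundle (e := (m (l + 1)).dim) (n := (m l).dim) (prolongProj E₀ l)

/-! ## Functions, vector fields and the Cartan distribution on the infinite prolongation -/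

/-- The algebra `C^∞(E)` of smooth functions on the infinite prolongation. -/
def Fun {k : ℕ} (E₀ : Set (Jet ζ k)) : Type _ :=
  smoothFunctions (Subtype.val : infProlong E₀ → Jet ζ ⊤)

instance {k : ℕ} (E₀ : Set (Jet ζ k)) : CommRing (Fun E₀) :=
  inferInstanceAs (CommRing (smoothFunctions (Subtype.val : infProlong E₀ → Jet ζ ⊤)))

instance {k : ℕ} (E₀ : Set (Jet ζ k)) : Algebra ℝ (Fun E₀) :=
  inferInstanceAs (Algebra ℝ (smoothFunctions (Subtype.val : infProlong E₀ → Jet ζ ⊤)))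

/-- The Lie algebra `D(E)` of vector fields on `E`: derivations of `C^∞(E)`. -/
abbrev Fields {k : ℕ} (E₀ : Set (Jet ζ k)) : Type _ := Derivation ℝ (Fun E₀) (Fun E₀)

/-- The restriction to `E` of a smooth function on `J^∞(ζ)`. -/
def restrictFun {k : ℕ} (E₀ : Set (Jet ζ k)) (F : Jet ζ ⊤ → ℝ)
    (hF : F ∈ smoothFunctions (id : Jet ζ ⊤ → Jet ζ ⊤)) : Fun E₀ :=
  ⟨F ∘ Subtype.val, smoothFunctions_comp id Subtype.val hF⟩

/-- The pullback `ξ^* : C^∞(M) → C^∞(E)` along the projection `ξ : E → M`. -/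
def basePullback {k : ℕ} (E₀ : Set (Jet ζ k)) : C^∞⟮𝓡 n, M; ℝ⟯ →ₐ[ℝ] Fun E₀ where
  toFun h := ⟨fun θ => h (Jet.base θ.1), 0, SmoothlyGenerated.of_mem
    ⟨h.comp ζ, [], by simp, le_rfl, by
      funext θ
      obtain ⟨_, s, x, hx, -, rfl⟩ := θ
      change h x = h (ζ (s.toFun x))
      rw [s.section_eq x hx]⟩⟩
  map_one' := rfl
  map_mul' _ _ := rfl
  map_zero' := rfl
  map_add' _ _ := rfl
  commutes' _ := rfl

/-- The submodule `CD ⊆ D(E)` of vector fields lying in the Cartan distribution: at each point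
`θ = [s]ₓ^∞` of `E` the field is tangent to the graph of `j_∞(s)`, i.e. it is the image under
`j_∞(s)` of a tangent vector `w` to `M` at `x`. -/
def cartan {k : ℕ} (E₀ : Set (Jet ζ k)) : Submodule (Fun E₀) (Fields E₀) where
  carrier := {Y | ∀ θ : infProlong E₀, ∃ w : TangentSpace (𝓡 n) (Jet.base θ.1),
    ∀ (s : LocalSection ζ) (hs : Jet.base θ.1 ∈ s.dom), jet ⊤ s (Jet.base θ.1) hs = θ.1 →
    ∀ (F : Jet ζ ⊤ → ℝ) (hF : F ∈ smoothFunctions (id : Jet ζ ⊤ → Jet ζ ⊤)),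
      (Y (restrictFun E₀ F hF)).1 θ = mfderiv (𝓡 n) 𝓘(ℝ, ℝ) (s.pull F) (Jet.base θ.1) w}
  add_mem' := by
    intro Y Y' h h' θ
    obtain ⟨w, hw⟩ := h θ
    obtain ⟨w', hw'⟩ := h' θ
    refine ⟨w + w', fun s hs e F hF => ?_⟩
    rw [map_add, ← hw s hs e F hF, ← hw' s hs e F hF]
    rfl
  zero_mem' := fun θ => ⟨0, fun s hs e F hF => by rw [map_zero]; rfl⟩
  smul_mem' := by
    intro a Y h θ
    obtain ⟨w, hw⟩ := h θ
    refine ⟨a.1 θ • w, fun s hs e F hF => ?_⟩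
    rw [map_smul, ← hw s hs e F hF]
    rfl

/-- The Lie algebra `sym E` of (higher) symmetries: `ξ`-vertical vector fields `S` on `E` which
preserve the Cartan distribution, `[S, CD] ⊆ CD`. -/
def sym {k : ℕ} (E₀ : Set (Jet ζ k)) : LieSubalgebra ℝ (Fields E₀) :=
  verticalPreserving (basePullback E₀) (cartan E₀)

end Jets

section FlatRepresentation

variable {b n n' : ℕ} {B M N : Type*}
  [TopologicalSpace B] [ChartedSpace (Euc b) B]
  [TopologicalSpace M] [ChartedSpace (Euc n) M] [IsManifold (𝓡 n) ∞ M]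
  [TopologicalSpace N] [ChartedSpace (Euc n') N]
  {ζ : C^∞⟮𝓡 b, B; 𝓡 n, M⟯} {k : ℕ}

/-- The pullback `η^* : C^∞(N) → C^∞(E)` along `η = π ∘ ξ : E → N`. -/
def totalPullback (E₀ : Set (Jet ζ k)) (π : C^∞⟮𝓡 n, M; 𝓡 n', N⟯) :
    C^∞⟮𝓡 n', N; ℝ⟯ →ₐ[ℝ] Fun E₀ :=
  (basePullback E₀).comp
    { toFun := fun g => g.comp π
      map_one' := rfl
      map_mul' := fun _ _ => rfl
      map_zero' := rfl
      map_add' := fun _ _ => rfl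
      commutes' := fun _ => rfl }

/-- A flat representation of the equation `E` over `π : M → N`: a flat connection `𝓕` in
`η = π ∘ ξ : E → N`, given as a `C^∞(E)`-linear map `D(N, E) → D(E)`, where `D(N, E)` is the
module of `C^∞(E)`-valued derivations of `C^∞(N)`, such that `𝓕(X)` lies in the Cartan
distribution for every vector field `X` on `N`. -/
structure FlatRepresentation (E₀ : Set (Jet ζ k)) (π : C^∞⟮𝓡 n, M; 𝓡 n', N⟯) where
  /-- the connection -/
  conn : RelDer (totalPullback E₀ π) →ₗ[Fun E₀] Fields E₀
  splits : ∀ X, resDer (totalPullback E₀ π) (conn X) = X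
  flat : ∀ X Y : Derivation ℝ C^∞⟮𝓡 n', N; ℝ⟯ C^∞⟮𝓡 n', N; ℝ⟯,
    ⁅conn (inclDer _ X), conn (inclDer _ Y)⁆ = conn (inclDer _ ⁅X, Y⁆)
  mem_cartan : ∀ X : Derivation ℝ C^∞⟮𝓡 n', N; ℝ⟯ C^∞⟮𝓡 n', N; ℝ⟯,
    conn (inclDer _ X) ∈ cartan E₀

variable {E₀ : Set (Jet ζ k)} {π : C^∞⟮𝓡 n, M; 𝓡 n', N⟯}

/-- The connection form `U ∈ D(Λ¹(E))`, given by `X ⌟ U(f) = 𝓕(X|_N)(f)`. -/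
def FlatRepresentation.form (𝓕 : FlatRepresentation E₀ π) : VForm (Fun E₀) 1 :=
  connForm (totalPullback E₀ π) 𝓕.conn

/-- The module `𝓥_E` of `η`-vertical vector fields lying in the Cartan distribution. -/
def verticalCartan (E₀ : Set (Jet ζ k)) (π : C^∞⟮𝓡 n, M; 𝓡 n', N⟯) :
    Submodule (Fun E₀) (Fields E₀) :=
  cartan E₀ ⊓ verticalDer (totalPullback E₀ π)

/-- The module `𝓥_E^q = η^*(Λ^q(N)) ⊗ 𝓥_E ⊆ D(Λ^q(E))` of `η`-horizontal `q`-forms on `E` with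
values in `𝓥_E`. -/
def deformationCochains (E₀ : Set (Jet ζ k)) (π : C^∞⟮𝓡 n, M; 𝓡 n', N⟯) (q : ℕ) :
    Submodule (Fun E₀) (VForm (Fun E₀) q) :=
  horizontalForms (totalPullback E₀ π) (verticalCartan E₀ π) q

/-- `c` is a `1`-cocycle of the deformation complex `(𝓥_E^•, ∂_U = ⟦U, ·⟧)`. -/
def FlatRepresentation.IsOneCocycle (𝓕 : FlatRepresentation E₀ π) (c : VForm (Fun E₀) 1) : Prop :=
  c ∈ deformationCochains E₀ π 1 ∧ IsNijenhuis 𝓕.form c 0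

/-- `c` is an exact `1`-cochain of the deformation complex: `c = ∂_U V = ⟦U, V⟧` with
`V ∈ 𝓥_E⁰ = 𝓥_E`. -/
def FlatRepresentation.IsExact (𝓕 : FlatRepresentation E₀ π) (c : VForm (Fun E₀) 1) : Prop :=
  ∃ V ∈ deformationCochains E₀ π 0, IsNijenhuis 𝓕.form V c

end FlatRepresentation

end FlatRep

end

noncomputable section

namespace FlatRep

/-! ### Low-degree formulas for the Nijenhuis bracket. -/

section NijenhuisFormulas

variable {A : Type*} [CommRing A] [Algebra ℝ A]

/-! Regard `U` as the endomorphism `P` sending `X` to `𝓕(X|_N)`. It is the projector of `D(E)` onto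
the range of the connection along the `η`-vertical fields, and `⟦U, S⟧` becomes `X ↦ P[S, X] - [S,
PX]`, the negative Lie derivative of `P` along `S` (`isNijenhuis_ofField_iff`).

Three facts follow. The values of `c_S` are `η`-vertical because `PX` and `X` agree on functions
from `N`, which `S` kills; they are Cartan because `P` has Cartan values and `S` preserves the
Cartan module (`connForm_adEnd_mem`). Flatness means that the torsion of `P` vanishes; this is a
quadratic identity in `P`, and differentiating it along `S` gives the polarised identity, which is
`∂_U c_S = 0` (`adEnd_bracket_eq_zero`). Finally, `c_S` is exact iff `S` differs by some `V ∈ 𝓥_E`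
from a field commuting with `P`; such fields are closed under brackets by Jacobi, and the correction
terms stay in `𝓥_E` (`exactSymmetries`).

Two analytic inputs remain. The connection is controlled only on fields coming from `N`, so a
partition into local coordinate fields extends this to all relative derivations
(`conn_mem_of_forall`, `conn_involutive_of_flat`). And the Cartan module must be involutive
(`cartan_lie_mem`). Here the graph of `j_∞(s)` may leave `E` away from the given point, so iterated
Cartan derivatives cannot be computed along it inside `E`; total derivatives, defined on all of
`J^∞`, replace them. -/

@[simp] theorem VForm.at_apply {j : ℕ} (Ω : VForm A j) (X : Fin j → Derivation ℝ A A) (f : A) :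
    Ω.at X f = Ω f X := rfl

/-- A `Λ¹`-valued derivation as an endomorphism of the module of derivations. -/
def VForm.toEnd (Ω : VForm A 1) : Derivation ℝ A A →ₗ[A] Derivation ℝ A A where
  toFun X := Ω.at fun _ => X
  map_add' X Y := by
    ext f
    exact map_add
      ((AlternatingMap.ofSubsingleton A (Derivation ℝ A A) A (0 : Fin 1)).symm (Ω f)) X Y
  map_smul' a X := by
    ext f
    exact map_smul
      ((AlternatingMap.ofSubsingleton A (Derivation ℝ A A) A (0 : Fin 1)).symm (Ω f)) a X

theorem VForm.at_eq_toEnd (Ω : VForm A 1) (X : Fin 1 → Derivation ℝ A A) :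
    Ω.at X = Ω.toEnd (X 0) := by
  have hX : X = fun _ => X 0 := by ext i : 1; fin_cases i; rfl
  conv_lhs => rw [hX]
  rfl

theorem VForm.apply_eq_toEnd (Ω : VForm A 1) (X : Fin 1 → Derivation ℝ A A) (f : A) :
    Ω f X = Ω.toEnd (X 0) f := by
  rw [← VForm.at_eq_toEnd, VForm.at_apply]

/-- An endomorphism of the module of derivations as a `Λ¹`-valued derivation. -/
def VForm.ofEnd (K : Derivation ℝ A A →ₗ[A] Derivation ℝ A A) : VForm A 1 :=
  connForm (AlgHom.id ℝ A)
    { toFun := fun X => K (Derivation.mk' X.1 fun a b => X.2 a b)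
      map_add' := fun X Y => by rw [← map_add]; rfl
      map_smul' := fun a X => by rw [RingHom.id_apply, ← map_smul]; rfl }

theorem VForm.toEnd_ofEnd (K : Derivation ℝ A A →ₗ[A] Derivation ℝ A A) :
    (VForm.ofEnd K).toEnd = K := rfl

theorem VForm.toEnd_injective : Function.Injective (VForm.toEnd (A := A)) := by
  intro Ω Ω' h
  ext f X
  rw [VForm.apply_eq_toEnd, VForm.apply_eq_toEnd, h]

theorem extD_zero_apply (w : PreForm A 0) (X : Fin 1 → Derivation ℝ A A) :
    extD w X = X 0 (w ![]) := by
  refine (Fin.sum_univ_one (M := A) _).trans ?_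
  simp [Subsingleton.elim _ (![] : Fin 0 → Derivation ℝ A A)]

theorem extD_one_apply (w : PreForm A 1) (X : Fin 2 → Derivation ℝ A A) :
    extD w X = X 0 (w ![X 1]) - X 1 (w ![X 0]) - w ![⁅X 0, X 1⁆] := by
  have h0 : (fun i : Fin 1 => X ((0 : Fin 2).succAbove i)) = ![X 1] := by
    ext i : 1; fin_cases i; rfl
  have h1 : (fun i : Fin 1 => X ((1 : Fin 2).succAbove i)) = ![X 0] := by
    ext i : 1; fin_cases i; rfl
  have h2 : Function.update ![X 0] 0 ⁅X 0, X 1⁆ = ![⁅X 0, X 1⁆] := by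
    ext i : 1; fin_cases i; rfl
  refine (Fin.sum_univ_two (M := A) _).trans ?_
  rw [h0, h1, Fin.sum_univ_one, Fin.sum_univ_one, if_neg (by decide), if_pos (by decide)]
  have h3 : (1 : Fin 2).succAbove 0 = 0 := rfl
  rw [h3, h2]
  simp
  ring

theorem inner_zero_one_apply (Ω : VForm A 0) (w : PreForm A 1) (X : Fin 0 → Derivation ℝ A A) :
    (inner Ω w : PreForm A 0) X = w ![Ω.at X] := by
  have hu : (Finset.univ : Finset (Equiv.Perm (Fin (0 + 0)))) = {1} := by decide
  have e1 : (Fin.cons (Ω.at fun a : Fin 0 => X ((1 : Equiv.Perm (Fin (0 + 0))) (Fin.castAdd 0 a)))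
      fun c : Fin 0 => X ((1 : Equiv.Perm (Fin (0 + 0))) (Fin.natAdd 0 c)) :
      Fin 1 → Derivation ℝ A A) = ![Ω.at X] := by
    ext i : 1; fin_cases i; rfl
  simp only [inner, hu, Finset.sum_singleton]
  rw [e1]
  simp

theorem inner_zero_two_apply (Ω : VForm A 0) (w : PreForm A 2) (X : Fin 1 → Derivation ℝ A A) :
    (inner Ω w : PreForm A (0 + 1)) X = w ![Ω.at ![], X 0] := by
  have hu : (Finset.univ : Finset (Equiv.Perm (Fin (0 + 1)))) = {1} := by decide
  have e1 : (Fin.cons (Ω.at fun a : Fin 0 => X ((1 : Equiv.Perm (Fin (0 + 1))) (Fin.castAdd 1 a)))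
      fun c : Fin 1 => X ((1 : Equiv.Perm (Fin (0 + 1))) (Fin.natAdd 0 c)) :
      Fin 2 → Derivation ℝ A A) = ![Ω.at ![], X 0] := by
    rw [Subsingleton.elim (fun a : Fin 0 => X _) ![]]
    ext i : 1; fin_cases i <;> rfl
  simp only [inner, hu, Finset.sum_singleton]
  rw [e1]
  simp

theorem inner_one_one_apply (Ω : VForm A 1) (w : PreForm A 1) (X : Fin 1 → Derivation ℝ A A) :
    (inner Ω w : PreForm A 1) X = w ![Ω.at X] := by
  have hu : (Finset.univ : Finset (Equiv.Perm (Fin (1 + 0)))) = {1} := by decide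
  have e1 : (Fin.cons (Ω.at fun a : Fin 1 => X ((1 : Equiv.Perm (Fin (1 + 0))) (Fin.castAdd 0 a)))
      fun c : Fin 0 => X ((1 : Equiv.Perm (Fin (1 + 0))) (Fin.natAdd 1 c)) :
      Fin 1 → Derivation ℝ A A) = ![Ω.at X] := by
    ext i : 1; fin_cases i; rfl
  simp only [inner, hu, Finset.sum_singleton]
  rw [e1]
  simp

theorem inner_one_two_apply (Ω : VForm A 1) (w : PreForm A 2) (X : Fin 2 → Derivation ℝ A A) :
    (inner Ω w : PreForm A 2) X = w ![Ω.at ![X 0], X 1] - w ![Ω.at ![X 1], X 0] := by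
  -- The two permutations of two arguments produce the two terms; the transposition carries the
  -- minus sign.
  have hu : (Finset.univ : Finset (Equiv.Perm (Fin (1 + 1)))) = {1, Equiv.swap 0 1} := by decide
  simp only [inner, hu]
  rw [Finset.sum_pair (by decide)]
  have e1 : (Fin.cons (Ω.at fun a : Fin 1 => X ((1 : Equiv.Perm (Fin (1 + 1))) (Fin.castAdd 1 a)))
      fun c : Fin 1 => X ((1 : Equiv.Perm (Fin (1 + 1))) (Fin.natAdd 1 c)) :
      Fin 2 → Derivation ℝ A A) = ![Ω.at ![X 0], X 1] := by
    have : (fun a : Fin 1 => X ((1 : Equiv.Perm (Fin (1+1))) (Fin.castAdd 1 a))) = ![X 0] := by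
      ext i : 1; fin_cases i; rfl
    rw [this]
    ext i : 1; fin_cases i <;> rfl
  have e2 : (Fin.cons
      (Ω.at fun a : Fin 1 => X ((Equiv.swap 0 1 : Equiv.Perm (Fin (1 + 1))) (Fin.castAdd 1 a)))
      fun c : Fin 1 => X ((Equiv.swap 0 1 : Equiv.Perm (Fin (1 + 1))) (Fin.natAdd 1 c)) :
      Fin 2 → Derivation ℝ A A) = ![Ω.at ![X 1], X 0] := by
    have : (fun a : Fin 1 =>
        X ((Equiv.swap 0 1 : Equiv.Perm (Fin (1 + 1))) (Fin.castAdd 1 a))) = ![X 1] := by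
      ext i : 1; fin_cases i; rfl
    rw [this]
    ext i : 1; fin_cases i <;> rfl
  rw [e1, e2, Equiv.Perm.sign_swap (by decide)]
  simp [sub_eq_add_neg]

theorem lieD_zero_preFun (Ω : VForm A 0) (f : A) :
    (lieD Ω (preFun f) : PreForm A 0) = fun X => Ω f X := by
  funext X
  change (-1 : A) ^ 0 * (inner Ω (extD (preFun f)) : PreForm A 0) X = _
  rw [inner_zero_one_apply, extD_zero_apply]
  simp [preFun]

theorem lieD_one_preFun (Ω : VForm A 1) (f : A) :
    (lieD Ω (preFun f) : PreForm A 1) = fun X => -Ω f X := by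
  funext X
  change (-1 : A) ^ 1 * (inner Ω (extD (preFun f)) : PreForm A 1) X = _
  rw [inner_one_one_apply, extD_zero_apply]
  simp [preFun]

theorem lieD_two_preFun_zero (f : A) :
    (lieD (0 : VForm A 2) (preFun f) : PreForm A 2) = 0 := by
  funext X
  change (-1 : A) ^ 2 * (inner (0 : VForm A 2) (extD (preFun f)) : PreForm A 2) X = _
  have : (inner (0 : VForm A 2) (extD (preFun f)) : PreForm A 2) X = 0 := by
    simp only [inner]
    rw [Finset.sum_eq_zero, smul_zero]
    intro σ _
    rw [extD_zero_apply]
    exact smul_zero _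
  rw [this, mul_zero]; rfl

theorem lieD_zero_one_apply (Ω : VForm A 0) (w : PreForm A 1) (X : Fin 1 → Derivation ℝ A A) :
    (lieD Ω w : PreForm A (0 + 1)) X = Ω.at ![] (w X) - w ![⁅Ω.at ![], X 0⁆] := by
  change extD (inner Ω w : PreForm A 0) X
    + (-1 : A) ^ 0 * (inner Ω (extD w) : PreForm A (0 + 1)) X = _
  have hX : ![X 0] = X := by ext i : 1; fin_cases i; rfl
  rw [extD_zero_apply, inner_zero_two_apply, inner_zero_one_apply, extD_one_apply]
  simp [hX]
  abel

theorem lieD_one_one_apply (Ω : VForm A 1) (w : PreForm A 1) (X : Fin 2 → Derivation ℝ A A) :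
    (lieD Ω w : PreForm A 2) X =
      Ω.at ![X 1] (w ![X 0]) - Ω.at ![X 0] (w ![X 1]) - w ![Ω.at ![⁅X 0, X 1⁆]]
        + w ![⁅Ω.at ![X 0], X 1⁆] - w ![⁅Ω.at ![X 1], X 0⁆] := by
  change extD (inner Ω w : PreForm A 1) X
    + (-1 : A) ^ 1 * (inner Ω (extD w) : PreForm A 2) X = _
  rw [extD_one_apply, inner_one_two_apply, inner_one_one_apply, inner_one_one_apply,
    inner_one_one_apply, extD_one_apply, extD_one_apply]
  simp
  ring

/-- On functions `L_Ψ` and `L_Ω` are `-Ψ` and `-Ω`, while `L_V` is `V` itself; the terms in which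
`V` is applied after `Ω` combine with the Lie derivative of the 1-form `Ω f` to leave commutators
only. -/
theorem isNijenhuis_one_zero_iff {Ω : VForm A 1} {V : VForm A 0} {Ψ : VForm A 1} :
    IsNijenhuis Ω V Ψ ↔ ∀ X : Derivation ℝ A A,
      Ψ.toEnd X = Ω.toEnd ⁅V.at ![], X⁆ - ⁅V.at ![], Ω.toEnd X⁆ := by
  have key : ∀ (f : A) (X : Fin 1 → Derivation ℝ A A),
      ((lieD Ψ (preFun f) : PreForm A 1) X =
        (lieD Ω (lieD V (preFun f) : PreForm A 0) : PreForm A 1) X -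
          (-1 : A) ^ (1 * 0) * (lieD V (lieD Ω (preFun f) : PreForm A 1) : PreForm A (0 + 1)) X) ↔
      Ψ.toEnd (X 0) f = (Ω.toEnd ⁅V.at ![], X 0⁆ - ⁅V.at ![], Ω.toEnd (X 0)⁆) f := by
    intro f X
    -- `L_V f` is again a function, so the degree-zero formula for `L_Ω` applies to it.
    have h0 : (fun Y => V f Y : PreForm A 0) = preFun (V f ![]) := by
      funext Y; rw [Subsingleton.elim Y ![]]; rfl
    rw [lieD_one_preFun, lieD_zero_preFun, h0, lieD_one_preFun, lieD_one_preFun,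
      lieD_zero_one_apply]
    simp only [VForm.apply_eq_toEnd, Derivation.sub_apply, Derivation.commutator_apply,
      VForm.at_apply, map_neg, Matrix.cons_val_zero]
    constructor
    · intro h
      linear_combination -h
    · intro h
      linear_combination -h
  constructor
  · intro h X
    ext f
    exact (key f fun _ => X).1 (h f fun _ => X)
  · intro h f X
    exact (key f X).2 (by rw [h])

/-- The hypothesis is the polarisation of the Nijenhuis torsion. For two odd forms the sign
`(-1)^{1·1}` turns the graded commutator into a sum, which is symmetric in `Ω` and `Ω'`. -/
theorem isNijenhuis_one_one_zero {Ω Ω' : VForm A 1}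
    (h : ∀ X Y : Derivation ℝ A A,
      ⁅Ω.toEnd X, Ω'.toEnd Y⁆ + ⁅Ω'.toEnd X, Ω.toEnd Y⁆ + Ω.toEnd (Ω'.toEnd ⁅X, Y⁆)
        + Ω'.toEnd (Ω.toEnd ⁅X, Y⁆) - Ω.toEnd ⁅Ω'.toEnd X, Y⁆ - Ω.toEnd ⁅X, Ω'.toEnd Y⁆
        - Ω'.toEnd ⁅Ω.toEnd X, Y⁆ - Ω'.toEnd ⁅X, Ω.toEnd Y⁆ = 0) :
    IsNijenhuis Ω Ω' 0 := by
  have key : ∀ (f : A) (X : Fin 2 → Derivation ℝ A A),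
      (lieD (0 : VForm A 2) (preFun f) : PreForm A 2) X =
        (lieD Ω (lieD Ω' (preFun f) : PreForm A 1) : PreForm A 2) X -
          (-1 : A) ^ (1 * 1) * (lieD Ω' (lieD Ω (preFun f) : PreForm A 1) : PreForm A 2) X := by
    intro f X
    rw [lieD_two_preFun_zero, lieD_one_preFun, lieD_one_preFun, lieD_one_one_apply,
      lieD_one_one_apply]
    have hf := congrArg (fun D : Derivation ℝ A A => D f) (h (X 0) (X 1))
    have hskew : ∀ Φ Φ' : VForm A 1, Φ'.toEnd ⁅Φ.toEnd (X 1), X 0⁆ f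
        = -Φ'.toEnd ⁅X 0, Φ.toEnd (X 1)⁆ f := by
      intro Φ Φ'
      rw [← lie_skew, map_neg, Derivation.neg_apply]
    simp only [VForm.apply_eq_toEnd, VForm.at_eq_toEnd, map_neg, Matrix.cons_val_zero, hskew]
    simp only [Derivation.sub_apply, Derivation.add_apply, Derivation.commutator_apply,
      Derivation.zero_apply] at hf
    rw [Pi.zero_apply]
    linear_combination -hf
  intro f X
  exact key f X

end NijenhuisFormulas

/-! ### Algebra of a flat connection and its projector. -/

section AbstractConnection

variable {A' A : Type*} [CommRing A'] [Algebra ℝ A'] [CommRing A] [Algebra ℝ A]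
  {ρ : A' →ₐ[ℝ] A} {conn : RelDer ρ →ₗ[A] Derivation ℝ A A}

theorem connForm_toEnd : (connForm ρ conn).toEnd = conn ∘ₗ resDer ρ := rfl

theorem mem_verticalDer {X : Derivation ℝ A A} : X ∈ verticalDer ρ ↔ ∀ g, X (ρ g) = 0 := by
  rw [verticalDer, LinearMap.mem_ker, Subtype.ext_iff, LinearMap.ext_iff]
  rfl

theorem verticalDer_lie_mem {X Y : Derivation ℝ A A} (hX : X ∈ verticalDer ρ)
    (hY : Y ∈ verticalDer ρ) : ⁅X, Y⁆ ∈ verticalDer ρ := by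
  rw [mem_verticalDer] at *
  intro g
  rw [Derivation.commutator_apply, hX, hY, map_zero, map_zero, sub_zero]

theorem connForm_toEnd_of_vertical {X : Derivation ℝ A A} (hX : X ∈ verticalDer ρ) :
    (connForm ρ conn).toEnd X = 0 := by
  rw [connForm_toEnd, LinearMap.comp_apply, LinearMap.mem_ker.1 hX, map_zero]

theorem sub_connForm_toEnd_mem (splits : ∀ X, resDer ρ (conn X) = X) (X : Derivation ℝ A A) :
    X - (connForm ρ conn).toEnd X ∈ verticalDer ρ := by
  rw [verticalDer, LinearMap.mem_ker, map_sub, connForm_toEnd, LinearMap.comp_apply, splits,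
    sub_self]

theorem connForm_toEnd_idem (splits : ∀ X, resDer ρ (conn X) = X) (X : Derivation ℝ A A) :
    (connForm ρ conn).toEnd ((connForm ρ conn).toEnd X) = (connForm ρ conn).toEnd X := by
  simp only [connForm_toEnd, LinearMap.comp_apply, splits]

/-- The Nijenhuis torsion of a connection with involutive horizontal distribution vanishes. -/
theorem connForm_torsion_eq_zero (splits : ∀ X, resDer ρ (conn X) = X)
    (flat : ∀ Z W, conn (resDer ρ ⁅conn Z, conn W⁆) = ⁅conn Z, conn W⁆)
    (X Y : Derivation ℝ A A) {P : Derivation ℝ A A →ₗ[A] Derivation ℝ A A}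
    (hP : P = (connForm ρ conn).toEnd) :
    ⁅P X, P Y⁆ + P (P ⁅X, Y⁆) - P ⁅P X, Y⁆ - P ⁅X, P Y⁆ = 0 := by
  subst hP
  -- `X - PX` and `Y - PY` are vertical, hence so is their bracket, and `P` kills it. Expanding
  -- gives the torsion once `P[PX, PY] = [PX, PY]` and `P² = P` are used.
  have h := connForm_toEnd_of_vertical (conn := conn)
    (verticalDer_lie_mem (sub_connForm_toEnd_mem splits X) (sub_connForm_toEnd_mem splits Y))
  have h2 : (connForm ρ conn).toEnd ⁅(connForm ρ conn).toEnd X, (connForm ρ conn).toEnd Y⁆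
      = ⁅(connForm ρ conn).toEnd X, (connForm ρ conn).toEnd Y⁆ := flat _ _
  rw [connForm_toEnd_idem splits]
  simp only [sub_lie, lie_sub, map_sub, h2] at h
  rw [← h]
  abel

theorem smul_lie_smul (a b : A) (X Y : Derivation ℝ A A) :
    ⁅a • X, b • Y⁆ = (a * b) • ⁅X, Y⁆ + (a * X b) • Y - (b * Y a) • X := by
  ext f
  simp only [Derivation.commutator_apply, Derivation.smul_apply, Derivation.leibniz,
    Derivation.add_apply, Derivation.sub_apply, smul_eq_mul]
  ring

/-- The endomorphism `X ↦ P [S, X] - [S, P X]`, the negative Lie derivative of `P` along `S`. -/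
def adEnd (P : Derivation ℝ A A →ₗ[A] Derivation ℝ A A) (S : Derivation ℝ A A) :
    Derivation ℝ A A →ₗ[A] Derivation ℝ A A where
  toFun X := P ⁅S, X⁆ - ⁅S, P X⁆
  map_add' X Y := by
    rw [lie_add, map_add, map_add, lie_add]
    abel
  -- The two Leibniz terms `S(a) • PX` cancel, so the commutator with `S` is `A`-linear.
  map_smul' a X := by
    have h : ∀ Z : Derivation ℝ A A, ⁅S, a • Z⁆ = a • ⁅S, Z⁆ + S a • Z := fun Z => by
      simp
    rw [h, map_smul, h, map_add, map_smul, map_smul, RingHom.id_apply, smul_sub]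
    abel

theorem adEnd_apply (P : Derivation ℝ A A →ₗ[A] Derivation ℝ A A) (S X : Derivation ℝ A A) :
    adEnd P S X = P ⁅S, X⁆ - ⁅S, P X⁆ := rfl

theorem isNijenhuis_ofField_iff {Ω Ψ : VForm A 1} {V : VForm A 0} :
    IsNijenhuis Ω V Ψ ↔ Ψ.toEnd = adEnd Ω.toEnd (V.at ![]) := by
  rw [isNijenhuis_one_zero_iff, LinearMap.ext_iff]
  rfl

theorem existsUnique_isNijenhuis (Ω : VForm A 1) (V : VForm A 0) :
    ∃! c : VForm A 1, IsNijenhuis Ω V c :=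
  ⟨VForm.ofEnd (adEnd Ω.toEnd (V.at ![])), isNijenhuis_ofField_iff.2 (VForm.toEnd_ofEnd _),
    fun _ hc => VForm.toEnd_injective (isNijenhuis_ofField_iff.1 hc)⟩

/-- With `T` the torsion of `P`, the left side is `T([S, X], Y) + T(X, [S, Y]) - [S, T(X, Y)]`: by
the Jacobi identity, the Lie derivative of a quadratic expression in `P` is its polarisation. All
three terms vanish. -/
theorem adEnd_bracket_eq_zero {P : Derivation ℝ A A →ₗ[A] Derivation ℝ A A}
    (tor : ∀ X Y, ⁅P X, P Y⁆ + P (P ⁅X, Y⁆) - P ⁅P X, Y⁆ - P ⁅X, P Y⁆ = 0)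
    (S X Y : Derivation ℝ A A) :
    ⁅P X, adEnd P S Y⁆ + ⁅adEnd P S X, P Y⁆ + P (adEnd P S ⁅X, Y⁆)
        + adEnd P S (P ⁅X, Y⁆) - P ⁅adEnd P S X, Y⁆ - P ⁅X, adEnd P S Y⁆
        - adEnd P S ⁅P X, Y⁆ - adEnd P S ⁅X, P Y⁆ = 0 := by
  have h1 := congrArg (fun D => ⁅S, D⁆) (tor X Y)
  have h2 := tor ⁅S, X⁆ Y
  have h3 := tor X ⁅S, Y⁆
  simp only [adEnd_apply]
  simp only [lie_add, lie_sub, lie_zero, leibniz_lie S] at h1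
  simp only [lie_sub, sub_lie, map_sub, leibniz_lie S, map_add]
  have h : ∀ {a b c : Derivation ℝ A A}, a = 0 → b = 0 → c = 0 → b + c - a = 0 := by
    intro a b c ha hb hc
    rw [ha, hb, hc]; simp
  rw [← h h1 h2 h3]
  abel

variable {A'' : Type*} [CommRing A''] [Algebra ℝ A''] {ρ₀ : A'' →ₐ[ℝ] A}
  {C : Submodule A (Derivation ℝ A A)}

/-- Since `ρ` factors through `ρ₀`, the field `S` kills the image of `ρ` and is itself `ρ`-vertical.
Horizontality holds because `P` kills both a vertical `X` and the vertical field `[S, X]`. -/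
theorem connForm_adEnd_mem {S : Derivation ℝ A A} (splits : ∀ X, resDer ρ (conn X) = X)
    (hC : ∀ X, conn X ∈ C) (hρ : ∀ g, ∃ h, ρ g = ρ₀ h) (hS : S ∈ verticalPreserving ρ₀ C)
    {c : VForm A 1} (hc : c.toEnd = adEnd (connForm ρ conn).toEnd S) :
    c ∈ horizontalForms ρ (C ⊓ verticalDer ρ) 1 := by
  have hSρ : ∀ g, S (ρ g) = 0 := fun g => by
    obtain ⟨h, e⟩ := hρ g
    rw [e, hS.1 h]
  have hP : ∀ X g, (connForm ρ conn).toEnd X (ρ g) = X (ρ g) := by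
    intro X g
    have := mem_verticalDer.1 (sub_connForm_toEnd_mem splits X) g
    rw [Derivation.sub_apply, sub_eq_zero] at this
    exact this.symm
  constructor
  · intro X
    rw [VForm.at_eq_toEnd, hc, adEnd_apply]
    refine ⟨sub_mem (hC _) (hS.2 _ (hC _)), mem_verticalDer.2 fun g => ?_⟩
    rw [Derivation.sub_apply, hP, Derivation.commutator_apply, Derivation.commutator_apply, hP,
      hSρ, map_zero, map_zero, sub_self]
  · rintro X ⟨a, ha⟩
    rw [Subsingleton.elim a 0] at ha
    have hv : ⁅S, X 0⁆ ∈ verticalDer ρ := verticalDer_lie_mem (mem_verticalDer.2 hSρ) ha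
    rw [VForm.at_eq_toEnd, hc, adEnd_apply, connForm_toEnd_of_vertical ha,
      connForm_toEnd_of_vertical hv, lie_zero, sub_zero]

theorem adEnd_add (P : Derivation ℝ A A →ₗ[A] Derivation ℝ A A) (S T : Derivation ℝ A A) :
    adEnd P (S + T) = adEnd P S + adEnd P T := by
  ext1 X
  simp only [adEnd_apply, LinearMap.add_apply, add_lie, map_add]
  abel

theorem adEnd_smul (P : Derivation ℝ A A →ₗ[A] Derivation ℝ A A) (r : ℝ)
    (S : Derivation ℝ A A) : adEnd P (r • S) = r • adEnd P S := by
  ext1 X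
  simp only [adEnd_apply, LinearMap.smul_apply, smul_lie, LinearMap.map_smul_of_tower, smul_sub]

/-- `adEnd P S = 0` says that `ad S` commutes with `P`, and by Jacobi `ad [S, T]` is the commutator
of `ad S` and `ad T`. -/
theorem adEnd_lie (P : Derivation ℝ A A →ₗ[A] Derivation ℝ A A) {S T : Derivation ℝ A A}
    (hS : adEnd P S = 0) (hT : adEnd P T = 0) : adEnd P ⁅S, T⁆ = 0 := by
  have h1 : ∀ X, P ⁅S, X⁆ = ⁅S, P X⁆ := fun X => sub_eq_zero.1 (LinearMap.congr_fun hS X)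
  have h2 : ∀ X, P ⁅T, X⁆ = ⁅T, P X⁆ := fun X => sub_eq_zero.1 (LinearMap.congr_fun hT X)
  ext1 X
  rw [adEnd_apply, lie_lie, lie_lie, map_sub, h1, h2, h2, h1, sub_self]
  rfl

/-- The elements of `verticalPreserving ρ₀ C` that differ by a vertical element of an involutive
`C` from a field whose flow preserves the connection. -/
def exactSymmetries (hρ : ∀ g, ∃ h, ρ g = ρ₀ h) (hC : ∀ X ∈ C, ∀ Y ∈ C, ⁅X, Y⁆ ∈ C)
    (P : Derivation ℝ A A →ₗ[A] Derivation ℝ A A) :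
    LieSubalgebra ℝ (verticalPreserving ρ₀ C) where
  carrier := {S | ∃ V ∈ C ⊓ verticalDer ρ, adEnd P S.1 = adEnd P V}
  add_mem' := by
    rintro S T ⟨V, hV, h⟩ ⟨W, hW, k⟩
    exact ⟨V + W, add_mem hV hW, by
      rw [adEnd_add, ← h, ← k]; exact adEnd_add P S.1 T.1⟩
  zero_mem' := ⟨0, zero_mem _, rfl⟩
  smul_mem' := by
    rintro r S ⟨V, hV, h⟩
    exact ⟨r • V, Submodule.smul_of_tower_mem _ r hV, by
      rw [adEnd_smul, ← h]; exact adEnd_smul P r S.1⟩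
  lie_mem' := by
    rintro ⟨S, hS⟩ ⟨T, hT⟩ ⟨V, hV, h⟩ ⟨W, hW, k⟩
    have hv : ∀ {S}, S ∈ verticalPreserving ρ₀ C → S ∈ verticalDer ρ := fun {S} hS =>
      mem_verticalDer.2 fun g => by
        obtain ⟨h, e⟩ := hρ g
        rw [e, hS.1 h]
    have sub0 : ∀ {S V : Derivation ℝ A A}, adEnd P S = adEnd P V → adEnd P (S - V) = 0 := by
      intro S V h
      have := adEnd_add P (S - V) V
      rw [sub_add_cancel, h] at this
      simpa using this
    have hlie := adEnd_lie P (sub0 h) (sub0 k)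
    -- `[S, T]` minus this field is `[S - V, T - W]`, a bracket of fields commuting with `P`. The
    -- field lies in `C` because `S`, `T` preserve `C` and `C` is involutive.
    refine ⟨⁅S, W⁆ - ⁅T, V⁆ - ⁅V, W⁆, ⟨?_, ?_⟩, ?_⟩
    · exact sub_mem (sub_mem (hS.2 _ hW.1) (hT.2 _ hV.1)) (hC _ hV.1 _ hW.1)
    · exact sub_mem (sub_mem (verticalDer_lie_mem (hv hS) hW.2) (verticalDer_lie_mem (hv hT) hV.2))
        (verticalDer_lie_mem hV.2 hW.2)
    · have e : ⁅S, T⁆ = ⁅S - V, T - W⁆ + (⁅S, W⁆ - ⁅T, V⁆ - ⁅V, W⁆) := by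
        rw [sub_lie, lie_sub, lie_sub, ← lie_skew T V]
        abel
      change adEnd P ⁅S, T⁆ = _
      rw [e, adEnd_add, hlie, zero_add]

end AbstractConnection

/-! ### Hadamard's lemma by integration over a parameter. -/

section Hadamard

open MeasureTheory Set Filter Topology

theorem hasFDerivAt_intervalIntegral_param {E F : Type} [NormedAddCommGroup E] [NormedSpace ℝ E]
    [FiniteDimensional ℝ E] [NormedAddCommGroup F] [NormedSpace ℝ F] [CompleteSpace F]
    {f : E × ℝ → F} (hf : ContDiff ℝ 1 f) (x : E) :
    HasFDerivAt (fun y => ∫ t in (0 : ℝ)..1, f (y, t))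
      (∫ t in (0 : ℝ)..1, (fderiv ℝ f (x, t)).comp (ContinuousLinearMap.inl ℝ E ℝ)) x := by
  have hc : Continuous fun z : E × ℝ =>
      (fderiv ℝ f z).comp (ContinuousLinearMap.inl ℝ E ℝ) :=
    (hf.continuous_fderiv one_ne_zero).clm_comp continuous_const
  -- A constant dominates the derivative on the compact set `closedBall x 1 × [0, 1]`.
  obtain ⟨C, hC⟩ := ((isCompact_closedBall x 1).prod
    (isCompact_Icc (a := (0 : ℝ)) (b := 1))).exists_bound_of_continuousOn
    hc.continuousOn
  have hfc := hf.continuous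
  refine intervalIntegral.hasFDerivAt_integral_of_dominated_of_fderiv_le
    (μ := volume) (F := fun y t => f (y, t))
    (F' := fun y t => (fderiv ℝ f (y, t)).comp (ContinuousLinearMap.inl ℝ E ℝ))
    (bound := fun _ => C) (Metric.ball_mem_nhds x one_pos)
    (Eventually.of_forall fun y =>
      (by fun_prop : Continuous fun t => f (y, t)).aestronglyMeasurable)
    ((by fun_prop : Continuous fun t => f (x, t)).intervalIntegrable 0 1)
    (hc.comp (by fun_prop : Continuous fun t : ℝ => (x, t))).aestronglyMeasurable
    (ae_of_all _ fun t ht y hy => hC (y, t) ⟨Metric.ball_subset_closedBall hy, ?_⟩)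
    intervalIntegrable_const
    (ae_of_all _ fun t ht y hy => ?_)
  · rw [uIoc_of_le zero_le_one] at ht
    exact ⟨ht.1.le, ht.2⟩
  · have h1 : HasFDerivAt f (fderiv ℝ f (y, t)) (y, t) :=
      (hf.differentiable one_ne_zero (y, t)).hasFDerivAt
    exact h1.comp y (hasFDerivAt_prodMk_left y t)

/-- The derivative is an integral of the same kind with values in `E →L[ℝ] F`, hence an induction on
the order with the target space varying. -/
theorem contDiff_intervalIntegral_param {E F : Type} [NormedAddCommGroup E] [NormedSpace ℝ E]
    [FiniteDimensional ℝ E] [NormedAddCommGroup F] [NormedSpace ℝ F] [CompleteSpace F]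
    {f : E × ℝ → F} (hf : ContDiff ℝ ∞ f) :
    ContDiff ℝ ∞ fun y => ∫ t in (0 : ℝ)..1, f (y, t) := by
  rw [contDiff_infty]
  intro m
  induction m generalizing F with
  | zero =>
    exact contDiff_zero.2 (continuous_iff_continuousAt.2 fun x =>
      (hasFDerivAt_intervalIntegral_param (hf.of_le (by exact_mod_cast le_top)) x).continuousAt)
  | succ m ih =>
    have h1 : ContDiff ℝ 1 f := hf.of_le (by exact_mod_cast le_top)
    rw [Nat.cast_succ, contDiff_succ_iff_fderiv]
    refine ⟨fun x => (hasFDerivAt_intervalIntegral_param h1 x).differentiableAt, by simp, ?_⟩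
    rw [funext fun x => (hasFDerivAt_intervalIntegral_param h1 x).fderiv]
    exact ih (f := fun z => (fderiv ℝ f z).comp (ContinuousLinearMap.inl ℝ E ℝ))
      ((hf.fderiv_right (by simp)).clm_comp contDiff_const)

/-- Hadamard's lemma. -/
theorem exists_contDiff_sub_eq {E : Type} [NormedAddCommGroup E] [NormedSpace ℝ E]
    [FiniteDimensional ℝ E] {G : E → ℝ} (hG : ContDiff ℝ ∞ G) (p : E) :
    ∃ H : E → E →L[ℝ] ℝ, ContDiff ℝ ∞ H ∧ ∀ y, G y - G p = H y (y - p) := by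
  have hs : ContDiff ℝ ∞ fun z : E × ℝ => fderiv ℝ G (p + z.2 • (z.1 - p)) :=
    (hG.fderiv_right (m := ∞) (by simp)).comp (by fun_prop)
  refine ⟨fun y => ∫ t in (0 : ℝ)..1, fderiv ℝ G (p + t • (y - p)),
    contDiff_intervalIntegral_param hs, fun y => ?_⟩
  have hcont : Continuous fun t : ℝ => fderiv ℝ G (p + t • (y - p)) :=
    hs.continuous.comp (by fun_prop : Continuous fun t : ℝ => (y, t))
  rw [ContinuousLinearMap.intervalIntegral_apply (hcont.intervalIntegrable 0 1)]
  have hd : ∀ t : ℝ, HasDerivAt (fun t : ℝ => G (p + t • (y - p)))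
      (fderiv ℝ G (p + t • (y - p)) (y - p)) t := by
    intro t
    have h2 : HasDerivAt (fun t : ℝ => p + t • (y - p)) (y - p) t := by
      simpa using ((hasDerivAt_id t).smul_const (y - p)).const_add p
    exact (hG.differentiable (by simp) _).hasFDerivAt.comp_hasDerivAt t h2
  rw [intervalIntegral.integral_eq_sub_of_hasDerivAt (fun t _ => hd t)
    ((hcont.clm_apply continuous_const).intervalIntegrable 0 1)]
  simp

end Hadamard

/-! ### Derivations at a point of a manifold, in local coordinates. -/

section PointDerivations

open Set Filter Topology

variable {n : ℕ} {M : Type*} [TopologicalSpace M] [ChartedSpace (Euc n) M]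
  [IsManifold (𝓡 n) ∞ M]

/-- A function that is smooth on a neighbourhood of `x` has the same germ as a global smooth
function. -/
theorem exists_smooth_eventuallyEq [T2Space M] {h : M → ℝ} {u : Set M} {x : M} (hu : u ∈ 𝓝 x)
    (hh : ContMDiffOn (𝓡 n) 𝓘(ℝ, ℝ) ∞ h u) :
    ∃ k : C^∞⟮𝓡 n, M; ℝ⟯, k =ᶠ[𝓝 x] h := by
  obtain ⟨f, -, hf⟩ := (SmoothBumpFunction.nhds_basis_tsupport (I := 𝓡 n) x).mem_iff.1
    (interior_mem_nhds.2 hu)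
  refine ⟨⟨fun y => f y • h y, contMDiff_of_tsupport fun y hy => ?_⟩, ?_⟩
  · have hy' : y ∈ interior u := hf (tsupport_smul_subset_left _ _ hy)
    exact f.contMDiffAt.smul (hh.contMDiffAt (mem_interior_iff_mem_nhds.1 hy'))
  · filter_upwards [f.eventuallyEq_one] with y hy
    change f y • h y = h y
    rw [hy, Pi.one_apply, one_smul]

/-- A derivation of the algebra of smooth functions at the point `x`. -/
def IsPointDerivation (x : M) (D : C^∞⟮𝓡 n, M; ℝ⟯ →ₗ[ℝ] ℝ) : Prop :=
  ∀ f g, D (f * g) = f x * D g + g x * D f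

omit [IsManifold (𝓡 n) ∞ M] in
theorem IsPointDerivation.map_const {x : M} {D : C^∞⟮𝓡 n, M; ℝ⟯ →ₗ[ℝ] ℝ}
    (hD : IsPointDerivation x D) (c : ℝ) : D (algebraMap ℝ _ c) = 0 := by
  have h1 := hD 1 1
  rw [one_mul] at h1
  have h2 : D 1 = 0 := by
    have : (1 : C^∞⟮𝓡 n, M; ℝ⟯) x = 1 := rfl
    rw [this] at h1
    linarith
  rw [Algebra.algebraMap_eq_smul_one, map_smul, h2, smul_zero]

/-- Locality: a bump function `χ` supported where `f = g` has `χ(f - g) = 0`, and the Leibniz rule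
at `x`, where `χ = 1`, gives `D(f - g) = 0`. -/
theorem IsPointDerivation.congr [T2Space M] {x : M} {D : C^∞⟮𝓡 n, M; ℝ⟯ →ₗ[ℝ] ℝ}
    (hD : IsPointDerivation x D) {f g : C^∞⟮𝓡 n, M; ℝ⟯} (h : f =ᶠ[𝓝 x] g) : D f = D g := by
  obtain ⟨χ, -, hχ⟩ := (SmoothBumpFunction.nhds_basis_tsupport (I := 𝓡 n) x).mem_iff.1 h
  let k : C^∞⟮𝓡 n, M; ℝ⟯ := ⟨χ, χ.contMDiff⟩
  have hk : k * (f - g) = 0 := by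
    ext y
    change χ y * (f y - g y) = 0
    by_cases hy : y ∈ tsupport χ
    · have e : f y = g y := hχ hy
      rw [e, sub_self, mul_zero]
    · rw [image_eq_zero_of_notMem_tsupport hy, zero_mul]
  have h1 := hD k (f - g)
  have h2 : k x = 1 := χ.eq_one
  have h3 : (f - g) x = 0 := sub_eq_zero.2 h.self_of_nhds
  rw [hk, map_zero, h2, h3, zero_mul, add_zero, one_mul, map_sub] at h1
  exact sub_eq_zero.1 h1.symm

theorem contMDiffOn_dirDeriv (Z : VecField n M) {h : M → ℝ} {u : Set M} (hu : IsOpen u)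
    (hh : ContMDiffOn (𝓡 n) 𝓘(ℝ, ℝ) ∞ h u) :
    ContMDiffOn (𝓡 n) 𝓘(ℝ, ℝ) ∞ (dirDeriv Z h) u := by
  have h1 := (hh.contMDiffOn_tangentMapWithin (m := ∞) (by simp) hu.uniqueMDiffOn).comp
    (Z.contMDiff.contMDiffOn (s := u)) (fun y hy => hy)
  have h2 := (contMDiff_snd_tangentBundle_modelSpace ℝ 𝓘(ℝ, ℝ) (n := ∞)).comp_contMDiffOn h1
  refine h2.congr fun y hy => ?_
  change mfderiv (𝓡 n) 𝓘(ℝ, ℝ) h y (Z y) = mfderivWithin (𝓡 n) 𝓘(ℝ, ℝ) h u y (Z y)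
  rw [mfderivWithin_of_isOpen hu hy]

theorem dirDeriv_congr (Z : VecField n M) {h k : M → ℝ} {x : M} (e : h =ᶠ[𝓝 x] k) :
    dirDeriv Z h =ᶠ[𝓝 x] dirDeriv Z k := by
  filter_upwards [e.eventuallyEq_nhds] with y hy
  rw [dirDeriv, dirDeriv, hy.mfderiv_eq]
  rfl

/-- The derivation of smooth functions at `x` given by a tangent vector. -/
def tangentDer (x : M) (w : TangentSpace (𝓡 n) x) : C^∞⟮𝓡 n, M; ℝ⟯ →ₗ[ℝ] ℝ where
  toFun h := mfderiv (𝓡 n) 𝓘(ℝ, ℝ) h x w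
  map_add' f g := by
    change mfderiv (𝓡 n) 𝓘(ℝ, ℝ) (f + g : M → ℝ) x w = _
    rw [mfderiv_add f.mdifferentiableAt g.mdifferentiableAt]
    rfl
  map_smul' c f := by
    change mfderiv (𝓡 n) 𝓘(ℝ, ℝ) (c • (f : M → ℝ)) x w = _
    rw [const_smul_mfderiv f.mdifferentiableAt]
    rfl

omit [IsManifold (𝓡 n) ∞ M] in
theorem isPointDerivation_tangentDer (x : M) (w : TangentSpace (𝓡 n) x) :
    IsPointDerivation x (tangentDer x w) := by
  intro f g
  change mfderiv (𝓡 n) 𝓘(ℝ, ℝ) (f * g : M → ℝ) x w = _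
  rw [(f.mdifferentiableAt.hasMFDerivAt.mul g.mdifferentiableAt.hasMFDerivAt).mfderiv]
  rfl

/-- A vector field as a derivation of the algebra of smooth functions. -/
def VecField.toDer (Z : VecField n M) : Derivation ℝ C^∞⟮𝓡 n, M; ℝ⟯ C^∞⟮𝓡 n, M; ℝ⟯ :=
  Derivation.mk'
    { toFun := fun h => ⟨dirDeriv Z h, contMDiffOn_univ.1
        (contMDiffOn_dirDeriv Z isOpen_univ h.contMDiff.contMDiffOn)⟩
      map_add' := fun f g => by ext x; exact map_add (tangentDer x (Z x)) f g
      map_smul' := fun c f => by ext x; exact map_smul (tangentDer x (Z x)) c f }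
    (fun f g => by ext x; exact isPointDerivation_tangentDer x (Z x) f g)

theorem VecField.toDer_apply (Z : VecField n M) (h : C^∞⟮𝓡 n, M; ℝ⟯) (x : M) :
    VecField.toDer Z h x = tangentDer x (Z x) h := rfl

/-- Near every point of a chart domain, derivations at points are determined by their values on
the coordinates. -/
theorem exists_pointDerivation_eq_sum [T2Space M] {x₀ x : M} (hx : x ∈ (chartAt (Euc n) x₀).source)
    {c : Fin n → C^∞⟮𝓡 n, M; ℝ⟯} (hc : ∀ i, c i =ᶠ[𝓝 x] fun y => extChartAt (𝓡 n) x₀ y i)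
    (g : C^∞⟮𝓡 n, M; ℝ⟯) :
    ∃ a : Fin n → ℝ, ∀ D, IsPointDerivation x D → D g = ∑ i, a i * D (c i) := by
  set φ := extChartAt (𝓡 n) x₀ with hφ
  have hxs : x ∈ φ.source := by rwa [hφ, extChartAt_source]
  have hsn : φ.source ∈ 𝓝 x := extChartAt_source_mem_nhds' hxs
  have htn : φ.target ∈ 𝓝 (φ x) := extChartAt_target_mem_nhds' (φ.map_source hxs)
  have hφs : ContMDiffOn (𝓡 n) 𝓘(ℝ, Euc n) ∞ φ φ.source := by
    rw [hφ, extChartAt_source]; exact contMDiffOn_extChartAt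
  have hGs : ContMDiffOn 𝓘(ℝ, Euc n) 𝓘(ℝ, ℝ) ∞ (g ∘ φ.symm) φ.target :=
    g.contMDiff.comp_contMDiffOn (contMDiffOn_extChartAt_symm x₀)
  obtain ⟨G, hG⟩ := exists_smooth_eventuallyEq htn hGs
  obtain ⟨H, hH, hHG⟩ := exists_contDiff_sub_eq (contMDiff_iff_contDiff.1 G.contMDiff) (φ x)
  have hHi : ∀ i : Fin n, ∃ h : C^∞⟮𝓡 n, M; ℝ⟯,
      h =ᶠ[𝓝 x] fun y => H (φ y) (EuclideanSpace.single i 1) := by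
    intro i
    refine exists_smooth_eventuallyEq hsn ?_
    have h1 : ContMDiff 𝓘(ℝ, Euc n) 𝓘(ℝ, ℝ) ∞ fun z => H z (EuclideanSpace.single i 1) :=
      (hH.clm_apply contDiff_const).contMDiff
    exact h1.comp_contMDiffOn hφs
  choose h hh using hHi
  -- The coefficients are the Hadamard factors at `x`, which do not depend on `D`: in `(c i - φ x i)
  -- * h i` the first factor vanishes at `x`, so only `h i x * D (c i)` survives.
  refine ⟨fun i => h i x, fun D hD => ?_⟩
  have hg : g =ᶠ[𝓝 x] (algebraMap ℝ C^∞⟮𝓡 n, M; ℝ⟯ (g x) +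
      ∑ i, (c i - algebraMap ℝ _ (φ x i)) * h i : C^∞⟮𝓡 n, M; ℝ⟯) := by
    have hG' := (continuousAt_extChartAt' hxs).eventually hG
    filter_upwards [hG', eventually_all.2 hc, eventually_all.2 hh, hsn] with y hy hcy hhy hys
    have h0 : G (φ x) = g x := by
      rw [hG.self_of_nhds, Function.comp_apply, φ.left_inv hxs]
    have h1 : G (φ y) = g y := by
      rw [hy, Function.comp_apply, φ.left_inv hys]
    have h2 : ((algebraMap ℝ C^∞⟮𝓡 n, M; ℝ⟯ (g x) +
      ∑ i, (c i - algebraMap ℝ _ (φ x i)) * h i : C^∞⟮𝓡 n, M; ℝ⟯)) y =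
        g x + ∑ i, (c i y - φ x i) * h i y := by
      have := map_add (ContMDiffMap.coeFnAlgHom (I := 𝓡 n) (n := ∞) (N := M) (A := ℝ) (𝕜 := ℝ))
        (algebraMap ℝ C^∞⟮𝓡 n, M; ℝ⟯ (g x)) (∑ i, (c i - algebraMap ℝ _ (φ x i)) * h i)
      rw [map_sum] at this
      have := congrFun this y
      rw [Pi.add_apply, Finset.sum_apply] at this
      exact this
    rw [h2, ← h1, ← h0, ← sub_eq_iff_eq_add', hHG]
    have h3 : φ y - φ x = ∑ i, (φ y i - φ x i) • EuclideanSpace.single i (1 : ℝ) := by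
      have := (EuclideanSpace.basisFun (Fin n) ℝ).sum_repr (φ y - φ x)
      simpa using this.symm
    conv_lhs => rw [h3]
    rw [map_sum]
    refine Finset.sum_congr rfl fun i _ => ?_
    rw [map_smul, hcy, hhy, smul_eq_mul]
  rw [hD.congr hg, map_add, hD.map_const, zero_add, map_sum]
  refine Finset.sum_congr rfl fun i _ => ?_
  rw [hD, map_sub, hD.map_const, sub_zero]
  have : (c i - algebraMap ℝ C^∞⟮𝓡 n, M; ℝ⟯ (φ x i)) x = 0 := sub_eq_zero.2 (hc i).self_of_nhds
  rw [this, zero_mul, zero_add]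

/-- Near each point there are smooth functions and vector fields, local coordinates and the
corresponding coordinate fields cut off by `ψ`, in which derivations at points expand. -/
theorem exists_coordinates [T2Space M] (x₀ : M) :
    ∃ (c : Fin n → C^∞⟮𝓡 n, M; ℝ⟯) (Z : Fin n → VecField n M) (ψ : C^∞⟮𝓡 n, M; ℝ⟯),
      ψ x₀ = 1 ∧ ∀ x D, IsPointDerivation x D →
        ∀ g, ψ x * D g = ∑ i, D (c i) * VecField.toDer (Z i) g x := by
  -- Two nested cut-offs: `f` makes the coordinates global, and `χ` is supported where `f` is
  -- locally 1, so the `c i` are genuine coordinates wherever the fields `Z i` may be nonzero.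
  obtain ⟨f, -, -⟩ := (SmoothBumpFunction.nhds_basis_tsupport (I := 𝓡 n) x₀).mem_iff.1 univ_mem
  obtain ⟨χ, -, hχ⟩ := (SmoothBumpFunction.nhds_basis_tsupport (I := 𝓡 n) x₀).mem_iff.1
    (f.eventuallyEq_one.eventually_nhds)
  let ψ : C^∞⟮𝓡 n, M; ℝ⟯ := ⟨χ, χ.contMDiff⟩
  let c : Fin n → C^∞⟮𝓡 n, M; ℝ⟯ := fun i => ⟨fun y => f y • extChartAt (𝓡 n) x₀ y i,
    f.contMDiff_smul (by
      have h1 : ContMDiff 𝓘(ℝ, Euc n) 𝓘(ℝ, ℝ) ∞ fun z : Euc n => z i :=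
        (contDiff_piLp_apply 2).contMDiff
      exact h1.comp_contMDiffOn contMDiffOn_extChartAt)⟩
  let e := trivializationAt (Euc n) (TangentSpace (𝓡 n) : M → Type _) x₀
  have he : e.baseSet = (chartAt (Euc n) x₀).source := TangentBundle.trivializationAt_baseSet x₀
  let b := (EuclideanSpace.basisFun (Fin n) ℝ).toBasis
  let Z : Fin n → VecField n M := fun i => ⟨(χ : M → ℝ) • e.localFrame b i, by
    refine ContMDiffOn.smul_section_of_tsupport (u := e.baseSet) χ.contMDiff.contMDiffOn
      e.open_baseSet ?_ (e.contMDiffOn_localFrame_baseSet ∞ b i)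
    rw [he]
    exact χ.tsupport_subset_chartAt_source⟩
  refine ⟨c, Z, ψ, χ.eq_one, fun x D hD g => ?_⟩
  by_cases hx : x ∈ tsupport χ
  · have hxs : x ∈ (chartAt (Euc n) x₀).source := χ.tsupport_subset_chartAt_source hx
    have hxe : x ∈ e.baseSet := by rwa [he]
    have hf : f =ᶠ[𝓝 x] 1 := hχ hx
    have hc : ∀ i, c i =ᶠ[𝓝 x] fun y => extChartAt (𝓡 n) x₀ y i := by
      intro i
      filter_upwards [hf] with y hy
      change f y • extChartAt (𝓡 n) x₀ y i = _
      rw [hy, Pi.one_apply, one_smul]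
    obtain ⟨a, ha⟩ := exists_pointDerivation_eq_sum hxs hc g
    have hdx : MDifferentiableAt (𝓡 n) 𝓘(ℝ, Euc n) (extChartAt (𝓡 n) x₀) x :=
      (contMDiffAt_extChartAt' (n := ∞) hxs).mdifferentiableAt (by simp)
    have hZc : ∀ i j, tangentDer x (Z i x) (c j) = if i = j then χ x else 0 := by
      intro i j
      have h1 : mfderiv (𝓡 n) 𝓘(ℝ, Euc n) (extChartAt (𝓡 n) x₀) x (e.localFrame b i x)
          = EuclideanSpace.single i (1 : ℝ) := by
        rw [← TangentBundle.continuousLinearMapAt_trivializationAt hxs,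
          e.localFrame_apply_of_mem_baseSet b hxe]
        have hb : b i = EuclideanSpace.single i (1 : ℝ) := by simp [b]
        have h2 : e.basisAt b hxe i = e.symmL ℝ x (b i) := by
          rw [Bundle.Trivialization.symmL_apply e hxe]
          simp [Bundle.Trivialization.basisAt]
        rw [h2]
        exact (e.continuousLinearMapAt_symmL (R := ℝ) hxe (b i)).trans hb
      have h2 : HasMFDerivAt (𝓡 n) 𝓘(ℝ, ℝ) (c j) x
          ((EuclideanSpace.proj j : Euc n →L[ℝ] ℝ).comp
            (mfderiv (𝓡 n) 𝓘(ℝ, Euc n) (extChartAt (𝓡 n) x₀) x)) :=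
        ((EuclideanSpace.proj j : Euc n →L[ℝ] ℝ).hasMFDerivAt.comp x
          hdx.hasMFDerivAt).congr_of_eventuallyEq (hc j)
      change mfderiv (𝓡 n) 𝓘(ℝ, ℝ) (c j) x (χ x • e.localFrame b i x) = _
      rw [map_smul, h2.mfderiv]
      have h3 : (EuclideanSpace.proj j : Euc n →L[ℝ] ℝ)
          (mfderiv (𝓡 n) 𝓘(ℝ, Euc n) (extChartAt (𝓡 n) x₀) x (e.localFrame b i x))
          = if i = j then 1 else 0 := by
        rw [h1]
        simp [eq_comm]
      refine (congrArg (χ x * ·) h3).trans ?_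
      rw [mul_ite, mul_one, mul_zero]
    rw [ha D hD, Finset.mul_sum]
    refine Finset.sum_congr rfl fun i _ => ?_
    -- Testing the expansion of `g` on the derivation `Z i x`, for which `Z i (c j) = χ δ_ij`,
    -- identifies its coefficient: `χ x * a i = Z i g (x)`.
    rw [VecField.toDer_apply, ha _ (isPointDerivation_tangentDer x (Z i x))]
    simp only [hZc, mul_ite, mul_zero, Finset.sum_ite_eq, Finset.mem_univ, if_true]
    change χ x * _ = _
    ring
  · have hx0 : χ x = 0 := image_eq_zero_of_notMem_tsupport hx
    have h0 : ∀ i, VecField.toDer (Z i) g x = 0 := by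
      intro i
      change mfderiv (𝓡 n) 𝓘(ℝ, ℝ) g x (χ x • e.localFrame b i x) = _
      rw [hx0, zero_smul, map_zero]
      rfl
    have : ψ x = 0 := hx0
    simp [h0, this]

end PointDerivations

/-! ### Passing from fields on the base to all relative derivations. -/

section Localization

variable {n : ℕ} {M : Type*} [TopologicalSpace M] [ChartedSpace (Euc n) M]
  [IsManifold (𝓡 n) ∞ M] [T2Space M] {A Θ : Type*} [CommRing A] [Algebra ℝ A]

/-- Near each point of the base, relative derivations expand in vector fields on the base. -/
theorem exists_smul_relDer_eq_sum {ev : Θ → A →ₐ[ℝ] ℝ}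
    (hev : ∀ a b, (∀ θ, ev θ a = ev θ b) → a = b)
    {ρ : C^∞⟮𝓡 n, M; ℝ⟯ →ₐ[ℝ] A} {η : Θ → M} (hρ : ∀ θ h, ev θ (ρ h) = h (η θ)) (x₀ : M) :
    ∃ (Z : Fin n → VecField n M) (ψ : C^∞⟮𝓡 n, M; ℝ⟯), ψ x₀ = 1 ∧
      ∀ X : RelDer ρ, ∃ a : Fin n → A,
        ρ ψ • X = ∑ i, a i • inclDer ρ (VecField.toDer (Z i)) := by
  obtain ⟨c, Z, ψ, hψ, h⟩ := exists_coordinates (n := n) x₀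
  refine ⟨Z, ψ, hψ, fun X => ⟨fun i => X.1 (c i), ?_⟩⟩
  ext g
  refine hev _ _ fun θ => ?_
  -- A relative derivation evaluated at a point `θ` is a point derivation at `η θ`, so the
  -- coordinate expansion applies pointwise with the global coefficients `X (c i)`.
  have hD : IsPointDerivation (η θ) ((ev θ).toLinearMap ∘ₗ X.1) := by
    intro f g
    change ev θ (X.1 (f * g)) = f (η θ) * ev θ (X.1 g) + g (η θ) * ev θ (X.1 f)
    rw [X.2 f g, map_add, map_mul, map_mul, hρ, hρ]
  have h1 := h _ _ hD g
  have h2 : (∑ i, X.1 (c i) • inclDer ρ (VecField.toDer (Z i)) : RelDer ρ).1 g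
      = ∑ i, X.1 (c i) * ρ (VecField.toDer (Z i) g) := by
    rw [AddSubmonoidClass.coe_finsetSum, LinearMap.sum_apply]
    rfl
  rw [h2, map_sum]
  change ev θ (ρ ψ * X.1 g) = _
  rw [map_mul, hρ]
  refine h1.trans (Finset.sum_congr rfl fun i _ => ?_)
  rw [map_mul, hρ]
  rfl

variable {ρ : C^∞⟮𝓡 n, M; ℝ⟯ →ₐ[ℝ] A} {conn : RelDer ρ →ₗ[A] Derivation ℝ A A}

theorem conn_mem_of_forall {ev : Θ → A →ₐ[ℝ] ℝ}
    (hev : ∀ a b, (∀ θ, ev θ a = ev θ b) → a = b)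
    {η : Θ → M} (hρ : ∀ θ h, ev θ (ρ h) = h (η θ)) {C : Submodule A (Derivation ℝ A A)}
    (hloc : ∀ Y, (∀ θ, ∃ a, ev θ a = 1 ∧ a • Y ∈ C) → Y ∈ C)
    (hC : ∀ X, conn (inclDer ρ X) ∈ C) (X : RelDer ρ) : conn X ∈ C := by
  refine hloc _ fun θ => ?_
  obtain ⟨Z, ψ, hψ, h⟩ := exists_smul_relDer_eq_sum hev hρ (η θ)
  obtain ⟨a, ha⟩ := h X
  refine ⟨ρ ψ, by rw [hρ, hψ], ?_⟩
  rw [← map_smul, ha, map_sum]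
  exact sum_mem fun i _ => by rw [map_smul]; exact Submodule.smul_mem _ _ (hC _)

/-- Flatness is given only for fields on the base. Near each point these span all relative
derivations, and the extra Leibniz terms stay in the range of `conn`, on which `conn ∘ resDer` is
the identity. -/
theorem conn_involutive_of_flat {ev : Θ → A →ₐ[ℝ] ℝ}
    (hev : ∀ a b, (∀ θ, ev θ a = ev θ b) → a = b)
    {η : Θ → M} (hρ : ∀ θ h, ev θ (ρ h) = h (η θ))
    (splits : ∀ X, resDer ρ (conn X) = X)
    (flat : ∀ X Y, ⁅conn (inclDer ρ X), conn (inclDer ρ Y)⁆ = conn (inclDer ρ ⁅X, Y⁆))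
    (V W : RelDer ρ) : conn (resDer ρ ⁅conn V, conn W⁆) = ⁅conn V, conn W⁆ := by
  ext f
  refine hev _ _ fun θ => ?_
  obtain ⟨Z, ψ, hψ, h⟩ := exists_smul_relDer_eq_sum hev hρ (η θ)
  obtain ⟨a, ha⟩ := h V
  obtain ⟨b, hb⟩ := h W
  have mem : (ρ ψ * ρ ψ) • ⁅conn V, conn W⁆ ∈ LinearMap.range conn := by
    have h1 : ⁅ρ ψ • conn V, ρ ψ • conn W⁆ ∈ LinearMap.range conn := by
      rw [← map_smul, ← map_smul, ha, hb, map_sum, map_sum, sum_lie_sum]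
      refine sum_mem fun i _ => sum_mem fun j _ => ?_
      rw [map_smul, map_smul, smul_lie_smul, flat]
      exact sub_mem (add_mem (Submodule.smul_mem _ _ ⟨_, rfl⟩) (Submodule.smul_mem _ _ ⟨_, rfl⟩))
        (Submodule.smul_mem _ _ ⟨_, rfl⟩)
    rw [smul_lie_smul] at h1
    have h2 : ∀ (c : A) (X : RelDer ρ), c • conn X ∈ LinearMap.range conn := fun c X =>
      Submodule.smul_mem _ _ ⟨_, rfl⟩
    -- Adding and subtracting the Leibniz terms of `[ψ conn V, ψ conn W]` isolates `ψ² [conn V, conn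
    -- W]`.
    have h3 := sub_mem (add_mem h1 (h2 (ρ ψ * conn W (ρ ψ)) V)) (h2 (ρ ψ * conn V (ρ ψ)) W)
    convert h3 using 1
    abel
  obtain ⟨X, hX⟩ := mem
  have key : conn (resDer ρ ((ρ ψ * ρ ψ) • ⁅conn V, conn W⁆)) = (ρ ψ * ρ ψ) • ⁅conn V, conn W⁆ := by
    rw [← hX, splits]
  rw [map_smul, map_smul] at key
  have h1 := congrArg (fun D : Derivation ℝ A A => ev θ (D f)) key
  simpa [hρ, hψ] using h1

end Localization

/-! ### Total derivatives on the infinite jet space. -/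

section TotalDerivative

open Set Filter Topology

variable {b n : ℕ} {B M : Type*}
  [TopologicalSpace B] [ChartedSpace (Euc b) B]
  [TopologicalSpace M] [ChartedSpace (Euc n) M] [IsManifold (𝓡 n) ∞ M]
  {ζ : C^∞⟮𝓡 b, B; 𝓡 n, M⟯}

theorem LocalSection.contMDiffOn_iterDeriv (s : LocalSection ζ) (g : C^∞⟮𝓡 b, B; ℝ⟯)
    (Zs : List (VecField n M)) :
    ContMDiffOn (𝓡 n) 𝓘(ℝ, ℝ) ∞ (iterDeriv Zs fun y => g (s.toFun y)) s.dom := by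
  induction Zs with
  | nil => exact g.contMDiff.comp_contMDiffOn s.smooth
  | cons Z Zs ih => exact contMDiffOn_dirDeriv Z s.isOpen_dom ih

/-- `F` is a smooth function `H` of finitely many jet functions near `θ₀`. -/
structure JetExpansion (F : Jet ζ ⊤ → ℝ) (θ₀ : Jet ζ ⊤) where
  /-- index type -/
  ι : Type
  fintype : Fintype ι
  /-- the functions on the total space -/
  g : ι → C^∞⟮𝓡 b, B; ℝ⟯
  /-- the fields along which they are differentiated -/
  Zs : ι → List (VecField n M)
  /-- the smooth function -/
  H : (ι → ℝ) → ℝ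
  smooth : ContDiff ℝ ∞ H
  /-- the size of the neighbourhood -/
  ε : ℝ
  pos : 0 < ε
  eq : ∀ θ, (∀ i, |jetCoord (g i) (Zs i) le_top θ - jetCoord (g i) (Zs i) le_top θ₀| < ε) →
    F θ = H fun i => jetCoord (g i) (Zs i) le_top θ

attribute [instance] JetExpansion.fintype

variable {F : Jet ζ ⊤ → ℝ} {θ₀ : Jet ζ ⊤}

/-- The jet functions of an expansion. -/
def JetExpansion.coord (e : JetExpansion F θ₀) (i : e.ι) (θ : Jet ζ ⊤) : ℝ :=
  jetCoord (e.g i) (e.Zs i) le_top θ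

theorem exists_jetExpansion {r : ℕ}
    (hF : SmoothlyGenerated (jetCoords (id : Jet ζ ⊤ → Jet ζ ⊤) r) F) (θ₀ : Jet ζ ⊤) :
    ∃ e : JetExpansion F θ₀, ∀ i, (e.Zs i).length ≤ r := by
  obtain ⟨ι, hι, φ, H, h1, h2, ε, hε, h3⟩ := hF θ₀
  choose g Zs hZ hr e using h1
  obtain rfl : φ = fun i θ => jetCoord (g i) (Zs i) le_top θ := funext e
  exact ⟨⟨ι, hι, g, Zs, H, h2, ε, hε, h3⟩, hr⟩

/-- The jet functions are continuous along `s`, so the strict inequalities defining the domain of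
the expansion persist near `x`. -/
theorem JetExpansion.pull_eventuallyEq (e : JetExpansion F θ₀) (s : LocalSection ζ) {x : M}
    (hx : x ∈ s.dom) (hn : ∀ i, |e.coord i (jet ⊤ s x hx) - e.coord i θ₀| < e.ε) :
    s.pull F =ᶠ[𝓝 x] fun y => e.H fun i => iterDeriv (e.Zs i) (fun y => e.g i (s.toFun y)) y := by
  have hc : ∀ i, ∀ᶠ y in 𝓝 x,
      |iterDeriv (e.Zs i) (fun y => e.g i (s.toFun y)) y - e.coord i θ₀| < e.ε := by
    intro i
    have h1 : ContinuousAt (iterDeriv (e.Zs i) fun y => e.g i (s.toFun y)) x :=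
      ((s.contMDiffOn_iterDeriv (e.g i) (e.Zs i)).continuousOn).continuousAt
        (s.isOpen_dom.mem_nhds hx)
    exact ((h1.sub continuousAt_const).abs).eventually_lt continuousAt_const (hn i)
  filter_upwards [s.isOpen_dom.mem_nhds hx, eventually_all.2 hc] with y hy hcy
  rw [LocalSection.pull, dif_pos hy]
  exact e.eq (jet ⊤ s y hy) hcy

/-- The chain rule. The right side involves only the jet of `s` at `x`, which makes the total
derivative well defined; allowing `jet ⊤ s x hx` to differ from `θ₀` makes the formula valid on a
whole neighbourhood. -/
theorem JetExpansion.dirDeriv_pull (e : JetExpansion F θ₀) (s : LocalSection ζ) {x : M}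
    (hx : x ∈ s.dom) (hn : ∀ i, |e.coord i (jet ⊤ s x hx) - e.coord i θ₀| < e.ε)
    (Z : VecField n M) [DecidableEq e.ι] :
    dirDeriv Z (s.pull F) x = ∑ i, fderiv ℝ e.H (fun i => e.coord i (jet ⊤ s x hx))
      (Pi.single i 1) * jetCoord (e.g i) (Z :: e.Zs i) le_top (jet ⊤ s x hx) := by
  rw [(dirDeriv_congr Z (e.pull_eventuallyEq s hx hn)).self_of_nhds]
  have h2 : MDifferentiableAt (𝓡 n) 𝓘(ℝ, e.ι → ℝ)
      (fun y i => iterDeriv (e.Zs i) (fun y => e.g i (s.toFun y)) y) x :=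
    (contMDiffAt_pi_space.2 fun i => (s.contMDiffOn_iterDeriv (e.g i) (e.Zs i)).contMDiffAt
      (s.isOpen_dom.mem_nhds hx)).mdifferentiableAt (n := ∞) (by simp)
  have h3 := ((e.smooth.differentiable (by simp)
    (fun i => e.coord i (jet ⊤ s x hx))).hasFDerivAt.hasMFDerivAt).comp x h2.hasMFDerivAt
  have h4 : ∀ i, dirDeriv Z (iterDeriv (e.Zs i) fun y => e.g i (s.toFun y)) x
      = (mfderiv (𝓡 n) 𝓘(ℝ, e.ι → ℝ)
        (fun y i => iterDeriv (e.Zs i) (fun y => e.g i (s.toFun y)) y) x (Z x) : e.ι → ℝ) i := by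
    intro i
    have h5 := ((ContinuousLinearMap.proj (R := ℝ) (φ := fun _ : e.ι => ℝ) i).hasMFDerivAt).comp x
      h2.hasMFDerivAt
    exact congrArg (fun L => L (Z x)) h5.mfderiv
  refine (congrArg (fun L => L (Z x)) h3.mfderiv).trans ?_
  change fderiv ℝ e.H (fun i => e.coord i (jet ⊤ s x hx)) (mfderiv (𝓡 n) 𝓘(ℝ, e.ι → ℝ)
        (fun y i => iterDeriv (e.Zs i) (fun y => e.g i (s.toFun y)) y) x (Z x) : e.ι → ℝ) = _
  conv_lhs => rw [← Finset.univ_sum_single (mfderiv (𝓡 n) 𝓘(ℝ, e.ι → ℝ)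
        (fun y i => iterDeriv (e.Zs i) (fun y => e.g i (s.toFun y)) y) x (Z x) : e.ι → ℝ)]
  rw [map_sum]
  refine Finset.sum_congr rfl fun i _ => ?_
  rw [← h4]
  change _ = _ * dirDeriv Z (iterDeriv (e.Zs i) fun y => e.g i (s.toFun y)) x
  generalize dirDeriv Z (iterDeriv (e.Zs i) fun y => e.g i (s.toFun y)) x = d
  have h6 : (Pi.single i d : e.ι → ℝ) = d • Pi.single i 1 := by
    rw [← Pi.single_smul, smul_eq_mul, mul_one]
  rw [h6, map_smul, smul_eq_mul, mul_comm]

theorem contMDiffOn_pull (hF : F ∈ smoothFunctions (id : Jet ζ ⊤ → Jet ζ ⊤))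
    (s : LocalSection ζ) : ContMDiffOn (𝓡 n) 𝓘(ℝ, ℝ) ∞ (s.pull F) s.dom := by
  obtain ⟨r, hr⟩ := hF
  intro x hx
  obtain ⟨e, -⟩ := exists_jetExpansion hr (jet ⊤ s x hx)
  have h1 : ContMDiffAt (𝓡 n) 𝓘(ℝ, e.ι → ℝ) ∞
      (fun y i => iterDeriv (e.Zs i) (fun y => e.g i (s.toFun y)) y) x :=
    contMDiffAt_pi_space.2 fun i => (s.contMDiffOn_iterDeriv (e.g i) (e.Zs i)).contMDiffAt
      (s.isOpen_dom.mem_nhds hx)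
  refine (((e.smooth.contMDiff.contMDiffAt).comp x h1).congr_of_eventuallyEq
    (e.pull_eventuallyEq s hx fun i => ?_)).contMDiffWithinAt
  rw [sub_self, abs_zero]
  exact e.pos

/-- A representative of an infinite jet. -/
def Jet.rep (θ : Jet ζ ⊤) : PointedSection ζ :=
  Quotient.out (s := jetSetoid ζ ⊤) θ

theorem Jet.jet_rep (θ : Jet ζ ⊤) : jet ⊤ θ.rep.sec θ.rep.pt θ.rep.mem = θ :=
  Quotient.out_eq (s := jetSetoid ζ ⊤) θ

/-- The total derivative of a function on `J^∞(ζ)` along a vector field on the base. -/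
def totalDeriv (Z : VecField n M) (F : Jet ζ ⊤ → ℝ) : Jet ζ ⊤ → ℝ := fun θ =>
  dirDeriv Z (θ.rep.sec.pull F) θ.rep.pt

theorem JetExpansion.totalDeriv_eq (e : JetExpansion F θ₀) (Z : VecField n M) {θ : Jet ζ ⊤}
    (hn : ∀ i, |e.coord i θ - e.coord i θ₀| < e.ε) [DecidableEq e.ι] :
    totalDeriv Z F θ = ∑ i, fderiv ℝ e.H (fun i => e.coord i θ)
      (Pi.single i 1) * jetCoord (e.g i) (Z :: e.Zs i) le_top θ := by
  have h1 := e.dirDeriv_pull θ.rep.sec θ.rep.mem (by rwa [Jet.jet_rep]) Z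
  rwa [Jet.jet_rep] at h1

/-- Independence of the representative chosen in `totalDeriv`: both sides have the same expansion in
jet functions. -/
theorem totalDeriv_jet (Z : VecField n M) (hF : F ∈ smoothFunctions (id : Jet ζ ⊤ → Jet ζ ⊤))
    (s : LocalSection ζ) {x : M} (hx : x ∈ s.dom) :
    totalDeriv Z F (jet ⊤ s x hx) = dirDeriv Z (s.pull F) x := by
  classical
  obtain ⟨r, hr⟩ := hF
  obtain ⟨e, -⟩ := exists_jetExpansion hr (jet ⊤ s x hx)
  have hn : ∀ i, |e.coord i (jet ⊤ s x hx) - e.coord i (jet ⊤ s x hx)| < e.ε := fun i => by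
    rw [sub_self, abs_zero]
    exact e.pos
  rw [e.totalDeriv_eq Z hn, e.dirDeriv_pull s hx hn]

theorem totalDeriv_mem (Z : VecField n M)
    (hF : F ∈ smoothFunctions (id : Jet ζ ⊤ → Jet ζ ⊤)) :
    totalDeriv Z F ∈ smoothFunctions (id : Jet ζ ⊤ → Jet ζ ⊤) := by
  classical
  obtain ⟨r, hr⟩ := hF
  -- Differentiating a jet function once more along `Z` raises its order by one.
  refine ⟨r + 1, fun θ₀ => ?_⟩
  obtain ⟨e, he⟩ := exists_jetExpansion hr θ₀
  refine ⟨e.ι ⊕ e.ι, inferInstance, Sum.elim e.coord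
    fun i => jetCoord (e.g i) (Z :: e.Zs i) le_top,
    fun y => ∑ i, fderiv ℝ e.H (fun i => y (Sum.inl i)) (Pi.single i 1) * y (Sum.inr i),
    ?_, ?_, e.ε, e.pos, ?_⟩
  · rintro (i | i)
    · exact ⟨e.g i, e.Zs i, le_top, (he i).trans r.le_succ, rfl⟩
    · exact ⟨e.g i, Z :: e.Zs i, le_top, Nat.succ_le_succ (he i), rfl⟩
  · have h1 : ContDiff ℝ ∞ (fderiv ℝ e.H) := e.smooth.fderiv_right (by simp)
    refine ContDiff.sum fun i _ => ContDiff.mul (ContDiff.clm_apply (h1.comp ?_) contDiff_const) ?_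
    · fun_prop
    · fun_prop
  · intro θ hθ
    exact e.totalDeriv_eq Z fun i => hθ (Sum.inl i)

theorem pull_totalDeriv (Z : VecField n M)
    (hF : F ∈ smoothFunctions (id : Jet ζ ⊤ → Jet ζ ⊤)) (s : LocalSection ζ) :
    EqOn (s.pull (totalDeriv Z F)) (dirDeriv Z (s.pull F)) s.dom := by
  intro y hy
  rw [← totalDeriv_jet Z hF s hy]
  exact dif_pos hy

end TotalDerivative

/-! ### Involutivity of the Cartan distribution. -/

section Cartan

open Set Filter Topology

theorem IsPointDerivation.exists_eq_tangentDer {n : ℕ} {M : Type*} [TopologicalSpace M]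
    [ChartedSpace (Euc n) M] [IsManifold (𝓡 n) ∞ M] [T2Space M] {x : M}
    {D : C^∞⟮𝓡 n, M; ℝ⟯ →ₗ[ℝ] ℝ} (hD : IsPointDerivation x D) :
    ∃ w, D = tangentDer x w := by
  obtain ⟨c, Z, ψ, hψ, h⟩ := exists_coordinates (n := n) x
  -- The cut-off `ψ` equals 1 at `x`, so the expansion of `D` in coordinate fields is exact there.
  refine ⟨∑ i, D (c i) • Z i x, LinearMap.ext fun g => ?_⟩
  have h1 := h x D hD g
  rw [hψ, one_mul] at h1
  rw [h1]
  change _ = mfderiv (𝓡 n) 𝓘(ℝ, ℝ) g x (∑ i, D (c i) • Z i x)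
  rw [map_sum]
  exact Finset.sum_congr rfl fun i _ => (map_smul (mfderiv (𝓡 n) 𝓘(ℝ, ℝ) g x) _ _).symm

variable {b n : ℕ} {B M : Type*}
  [TopologicalSpace B] [ChartedSpace (Euc b) B]
  [TopologicalSpace M] [ChartedSpace (Euc n) M] [IsManifold (𝓡 n) ∞ M]
  {ζ : C^∞⟮𝓡 b, B; 𝓡 n, M⟯} {k : ℕ} {E₀ : Set (Jet ζ k)}

/-- The value of a function at a point of the infinite prolongation. -/
def evalFun (θ : infProlong E₀) : Fun E₀ →ₐ[ℝ] ℝ where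
  toFun a := a.1 θ
  map_one' := rfl
  map_mul' _ _ := rfl
  map_zero' := rfl
  map_add' _ _ := rfl
  commutes' _ := rfl

theorem evalFun_ext (a c : Fun E₀) (h : ∀ θ : infProlong E₀, evalFun θ a = evalFun θ c) :
    a = c :=
  Subtype.ext (funext h)

/-- The Cartan condition is pointwise, so a multiplier equal to 1 at `θ` does not affect it there.
-/
theorem mem_cartan_of_forall (Y : Fields E₀)
    (h : ∀ θ : infProlong E₀, ∃ a, evalFun θ a = 1 ∧ a • Y ∈ cartan E₀) : Y ∈ cartan E₀ := by
  intro θ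
  obtain ⟨a, ha, hY⟩ := h θ
  obtain ⟨w, hw⟩ := hY θ
  refine ⟨w, fun s hs e F hF => ?_⟩
  rw [← hw s hs e F hF]
  change _ = evalFun θ (a * Y (restrictFun E₀ F hF))
  rw [map_mul, ha, one_mul]
  rfl

theorem Jet.exists_eq_jet (θ : Jet ζ ⊤) :
    ∃ (s : LocalSection ζ) (hs : θ.base ∈ s.dom), jet ⊤ s θ.base hs = θ := by
  induction θ using Quotient.inductionOn with
  | h σ => exact ⟨σ.sec, σ.mem, rfl⟩

/-- The pullback to `J^∞(ζ)` of a smooth function on the base is smooth. -/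
theorem comp_base_mem (h : C^∞⟮𝓡 n, M; ℝ⟯) :
    (fun θ => h θ.base) ∈ smoothFunctions (id : Jet ζ ⊤ → Jet ζ ⊤) :=
  ⟨0, SmoothlyGenerated.of_mem ⟨h.comp ζ, [], by simp, le_rfl, by
    funext θ
    induction θ using Quotient.inductionOn with
    | h σ =>
      change h σ.pt = h (ζ (σ.sec.toFun σ.pt))
      rw [σ.sec.section_eq σ.pt σ.mem]⟩⟩

theorem pull_comp_base_eventuallyEq (h : C^∞⟮𝓡 n, M; ℝ⟯) (s : LocalSection ζ) {x : M}
    (hx : x ∈ s.dom) : s.pull (k := ⊤) (fun θ => h θ.base) =ᶠ[𝓝 x] h := by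
  filter_upwards [s.isOpen_dom.mem_nhds hx] with y hy
  rw [LocalSection.pull, dif_pos hy]
  rfl

variable {Y Y' : Fields E₀} {F G : Jet ζ ⊤ → ℝ}
  {hF : F ∈ smoothFunctions (id : Jet ζ ⊤ → Jet ζ ⊤)}
  {hG : G ∈ smoothFunctions (id : Jet ζ ⊤ → Jet ζ ⊤)}
  {θ : infProlong E₀} {s : LocalSection ζ} {hs : Jet.base θ.1 ∈ s.dom}

theorem cartan_apply_congr (hY : Y ∈ cartan E₀) (e : jet ⊤ s (Jet.base θ.1) hs = θ.1)
    (h : s.pull F =ᶠ[𝓝 (Jet.base θ.1)] s.pull G) :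
    evalFun θ (Y (restrictFun E₀ F hF)) = evalFun θ (Y (restrictFun E₀ G hG)) := by
  obtain ⟨w, hw⟩ := hY θ
  refine (hw s hs e F hF).trans (Eq.trans ?_ (hw s hs e G hG).symm)
  rw [h.mfderiv_eq]
  rfl

theorem evalFun_restrict_totalDeriv (Z : VecField n M) (e : jet ⊤ s (Jet.base θ.1) hs = θ.1) :
    evalFun θ (restrictFun E₀ (totalDeriv Z F) (totalDeriv_mem Z hF))
      = dirDeriv Z (s.pull F) (Jet.base θ.1) := by
  rw [← totalDeriv_jet Z hF s hs, e]
  rfl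

/-- A Cartan field expands in total derivatives in the same way as its restriction to the base
expands in vector fields. -/
theorem cartan_smul_apply_eq_sum [T2Space M] (hY : Y ∈ cartan E₀) {ψ : C^∞⟮𝓡 n, M; ℝ⟯}
    {Z : Fin n → VecField n M} {a : Fin n → Fun E₀}
    (h : basePullback E₀ ψ • resDer (basePullback E₀) Y
      = ∑ i, a i • inclDer (basePullback E₀) (VecField.toDer (Z i)))
    (hF : F ∈ smoothFunctions (id : Jet ζ ⊤ → Jet ζ ⊤)) :
    basePullback E₀ ψ * Y (restrictFun E₀ F hF)
      = ∑ i, a i * restrictFun E₀ (totalDeriv (Z i) F) (totalDeriv_mem (Z i) hF) := by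
  refine evalFun_ext _ _ fun θ => ?_
  obtain ⟨s, hs, e⟩ := Jet.exists_eq_jet θ.1
  -- At `θ` a Cartan field sees only the germ of `F` along `s`, so `F` may be replaced by a function
  -- `g` on the base with that germ; for base functions the expansion is the hypothesis.
  obtain ⟨g, hg⟩ := exists_smooth_eventuallyEq (s.isOpen_dom.mem_nhds hs) (contMDiffOn_pull hF s)
  have h1 : evalFun θ (Y (restrictFun E₀ F hF)) = evalFun θ (Y (basePullback E₀ g)) :=
    cartan_apply_congr (hG := comp_base_mem g) hY e
      ((pull_comp_base_eventuallyEq g s hs).trans hg).symm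
  have h2 : basePullback E₀ ψ * Y (basePullback E₀ g)
      = ∑ i, a i * basePullback E₀ (VecField.toDer (Z i) g) := by
    have h3 := congrArg (fun X : RelDer (basePullback E₀) => X.1 g) h
    have h4 : (∑ i, a i • inclDer (basePullback E₀) (VecField.toDer (Z i))).1 g
        = ∑ i, a i * basePullback E₀ (VecField.toDer (Z i) g) := by
      rw [AddSubmonoidClass.coe_finsetSum, LinearMap.sum_apply]
      rfl
    exact h3.trans h4
  rw [map_mul, h1, ← map_mul, h2, map_sum, map_sum]
  refine Finset.sum_congr rfl fun i _ => ?_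
  rw [map_mul, map_mul, evalFun_restrict_totalDeriv (hF := hF) (Z i) e]
  congr 1
  exact (dirDeriv_congr (Z i) hg).self_of_nhds

/-- `Y' F` is known only on `E`, which need not contain the graph of `j_∞(s)`. Expanding `Y'` in
total derivatives with coefficients independent of `F` moves the problem to the functions
`totalDeriv (Z i) F` on `J^∞`, whose germs along `s` are determined by that of `F`. -/
theorem cartan_apply_apply_congr [T2Space M] (hY : Y ∈ cartan E₀) (hY' : Y' ∈ cartan E₀)
    (e : jet ⊤ s (Jet.base θ.1) hs = θ.1) (h : s.pull F =ᶠ[𝓝 (Jet.base θ.1)] s.pull G) :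
    evalFun θ (Y (Y' (restrictFun E₀ F hF))) = evalFun θ (Y (Y' (restrictFun E₀ G hG))) := by
  obtain ⟨Z, ψ, hψ, hZ⟩ := exists_smul_relDer_eq_sum (ρ := basePullback E₀)
    (η := fun θ => Jet.base θ.1) evalFun_ext (fun _ _ => rfl) (Jet.base θ.1)
  obtain ⟨a, ha⟩ := hZ (resDer _ Y')
  have hψθ : evalFun θ (basePullback E₀ ψ) = 1 := hψ
  have exp : ∀ {F : Jet ζ ⊤ → ℝ} (hF : F ∈ smoothFunctions (id : Jet ζ ⊤ → Jet ζ ⊤)),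
      evalFun θ (Y (Y' (restrictFun E₀ F hF))) =
        ∑ i, (evalFun θ (a i) * evalFun θ (Y (restrictFun E₀ _ (totalDeriv_mem (Z i) hF))) +
          evalFun θ (restrictFun E₀ _ (totalDeriv_mem (Z i) hF)) * evalFun θ (Y (a i)))
        - evalFun θ (Y' (restrictFun E₀ F hF)) * evalFun θ (Y (basePullback E₀ ψ)) := by
    intro F hF
    have h1 := congrArg (fun f => evalFun θ (Y f)) (cartan_smul_apply_eq_sum hY' ha hF)
    simp only [map_sum, Derivation.leibniz, map_add, smul_eq_mul, map_mul, hψθ, one_mul] at h1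
    exact eq_sub_of_add_eq h1
  rw [exp hF, exp hG, cartan_apply_congr (hG := hG) hY' e h]
  congr 1
  refine Finset.sum_congr rfl fun i _ => ?_
  have h1 := dirDeriv_congr (Z i) h
  have h2 : s.pull (totalDeriv (Z i) F) =ᶠ[𝓝 (Jet.base θ.1)] s.pull (totalDeriv (Z i) G) := by
    filter_upwards [s.isOpen_dom.mem_nhds hs, h1] with y hy e1
    rw [pull_totalDeriv (Z i) hF s hy, pull_totalDeriv (Z i) hG s hy, e1]
  rw [evalFun_restrict_totalDeriv (hF := hF) (Z i) e,
    evalFun_restrict_totalDeriv (hF := hG) (Z i) e,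
    h1.self_of_nhds, cartan_apply_congr (hG := totalDeriv_mem (Z i) hG) hY e h2]

/-- The Cartan distribution is involutive. -/
theorem cartan_lie_mem [T2Space M] (hY : Y ∈ cartan E₀) (hY' : Y' ∈ cartan E₀) :
    ⁅Y, Y'⁆ ∈ cartan E₀ := by
  intro θ
  have hD : IsPointDerivation (Jet.base θ.1)
      ((evalFun θ).toLinearMap ∘ₗ (resDer (basePullback E₀) ⁅Y, Y'⁆).1) := by
    intro f g
    change evalFun θ (⁅Y, Y'⁆ (basePullback E₀ (f * g))) =
      evalFun θ (basePullback E₀ f) * evalFun θ (⁅Y, Y'⁆ (basePullback E₀ g)) +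
        evalFun θ (basePullback E₀ g) * evalFun θ (⁅Y, Y'⁆ (basePullback E₀ f))
    rw [map_mul, Derivation.leibniz, map_add, smul_eq_mul, smul_eq_mul, map_mul, map_mul]
  -- The vector `w` must serve every `s` representing `θ`; it is read off from the action of the
  -- bracket on functions of the base, where `s` plays no role.
  obtain ⟨w, hw⟩ := hD.exists_eq_tangentDer
  refine ⟨w, fun s hs e F hF => ?_⟩
  obtain ⟨g, hg⟩ := exists_smooth_eventuallyEq (s.isOpen_dom.mem_nhds hs) (contMDiffOn_pull hF s)
  have h := ((pull_comp_base_eventuallyEq g s hs).trans hg).symm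
  have h1 : evalFun θ (⁅Y, Y'⁆ (restrictFun E₀ F hF)) =
      evalFun θ (⁅Y, Y'⁆ (basePullback E₀ g)) := by
    rw [Derivation.commutator_apply, Derivation.commutator_apply, map_sub, map_sub,
      cartan_apply_apply_congr (hG := comp_base_mem g) hY hY' e h,
      cartan_apply_apply_congr (hG := comp_base_mem g) hY' hY e h]
    rfl
  refine h1.trans ((LinearMap.congr_fun hw g).trans ?_)
  change mfderiv (𝓡 n) 𝓘(ℝ, ℝ) g (Jet.base θ.1) w = _
  rw [hg.mfderiv_eq]
  rfl

end Cartan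

end FlatRep

end

/-! ### The theorem for flat representations. -/

theorem mainTheorem5 {b n n' : ℕ} {B M N : Type*}
    [TopologicalSpace B] [ChartedSpace (EuclideanSpace ℝ (Fin b)) B] [IsManifold (𝓡 b) ∞ B]
    [T2Space B] [SecondCountableTopology B]
    [TopologicalSpace M] [ChartedSpace (EuclideanSpace ℝ (Fin n)) M] [IsManifold (𝓡 n) ∞ M]
    [T2Space M] [SecondCountableTopology M]
    [TopologicalSpace N] [ChartedSpace (EuclideanSpace ℝ (Fin n')) N] [IsManifold (𝓡 n') ∞ N]
    [T2Space N] [SecondCountableTopology N]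
    (ζ : C^∞⟮𝓡 b, B; 𝓡 n, M⟯) (hζ : FlatRep.IsSmoothFiberBundle (e := b) (n := n) ζ)
    (k : ℕ) (E₀ : Set (FlatRep.Jet ζ k)) (hE : FlatRep.IsFormallyIntegrable E₀)
    (π : C^∞⟮𝓡 n, M; 𝓡 n', N⟯) (hπ : FlatRep.IsSmoothFiberBundle (e := n) (n := n') π)
    (𝓕 : FlatRep.FlatRepresentation E₀ π) :
    (∀ S ∈ FlatRep.sym E₀, ∃! c : FlatRep.VForm (FlatRep.Fun E₀) 1,
      FlatRep.IsNijenhuis 𝓕.form (FlatRep.VForm.ofField S) c) ∧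
    (∀ S ∈ FlatRep.sym E₀, ∀ c : FlatRep.VForm (FlatRep.Fun E₀) 1,
      FlatRep.IsNijenhuis 𝓕.form (FlatRep.VForm.ofField S) c → 𝓕.IsOneCocycle c) ∧
    ∃ L : LieSubalgebra ℝ (FlatRep.sym E₀), ∀ S : FlatRep.sym E₀,
      S ∈ L ↔ ∃ c : FlatRep.VForm (FlatRep.Fun E₀) 1,
        FlatRep.IsNijenhuis 𝓕.form (FlatRep.VForm.ofField (S : FlatRep.Fields E₀)) c ∧
          𝓕.IsExact c := by
  have hev := FlatRep.evalFun_ext (E₀ := E₀)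
  have hη : ∀ (θ : FlatRep.infProlong E₀) (g : C^∞⟮𝓡 n', N; ℝ⟯),
      FlatRep.evalFun θ (FlatRep.totalPullback E₀ π g) = g (π (FlatRep.Jet.base θ.1)) :=
    fun _ _ => rfl
  have hC : ∀ X, 𝓕.conn X ∈ FlatRep.cartan E₀ :=
    FlatRep.conn_mem_of_forall hev (η := fun θ => π (FlatRep.Jet.base θ.1)) hη
      FlatRep.mem_cartan_of_forall 𝓕.mem_cartan
  have flat := FlatRep.conn_involutive_of_flat hev (η := fun θ => π (FlatRep.Jet.base θ.1)) hη
    𝓕.splits 𝓕.flat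
  have hρ : ∀ g, ∃ h, FlatRep.totalPullback E₀ π g = FlatRep.basePullback E₀ h :=
    fun _ => ⟨_, rfl⟩
  refine ⟨fun S _ => FlatRep.existsUnique_isNijenhuis _ _, fun S hS c hc => ?_,
    FlatRep.exactSymmetries hρ (fun X hX Y hY => FlatRep.cartan_lie_mem hX hY) 𝓕.form.toEnd,
    fun S => ?_⟩
  · rw [FlatRep.isNijenhuis_ofField_iff] at hc
    refine ⟨FlatRep.connForm_adEnd_mem 𝓕.splits hC hρ hS hc,
      FlatRep.isNijenhuis_one_one_zero ?_⟩
    rw [hc]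
    exact FlatRep.adEnd_bracket_eq_zero
      (fun X Y => FlatRep.connForm_torsion_eq_zero 𝓕.splits flat X Y rfl) S
  · constructor
    · rintro ⟨V, hV, h⟩
      -- The common value of the two brackets serves as `c`. In degree 0 there is no argument to be
      -- vertical, so horizontality of `V` is vacuous.
      refine ⟨FlatRep.VForm.ofEnd (FlatRep.adEnd 𝓕.form.toEnd V),
        FlatRep.isNijenhuis_ofField_iff.2 h.symm, FlatRep.VForm.ofField V,
        ⟨fun _ => hV, fun _ ⟨a, _⟩ => a.elim0⟩, FlatRep.isNijenhuis_ofField_iff.2 rfl⟩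
    · rintro ⟨c, hc, V, hV, hcV⟩
      exact ⟨V.at ![], hV.1 _, (FlatRep.isNijenhuis_ofField_iff.1 hc).symm.trans
        (FlatRep.isNijenhuis_ofField_iff.1 hcV)⟩
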